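/- Let $n\ge 1$, let $E$ be a closed subset of the unit circle $\mathbb T$, and let $a_0<b_0$ be real numbers such that the arc $\{e^{ix}:a_0<x<b_0\}$ is a gap of $E$, i.e. it does not meet $E$ and $e^{ia_0},e^{ib_0}\in E$. Let $\mathcal P_n(E)$ be the set of complex polynomials $P$ of degree at most $n$ with $|P(\zeta)|\le 1$ for all $\zeta\in E$. For $c\in(a_0,b_0)$, an extremizer at $c$ is a $P\in\mathcal P_n(E)$ that maximizes $|P(e^{ic})|$ over $\mathcal P_n(E)$. Fix $c_0\in(a_0,b_0)$. (1) If $E$ has more than $n$ points, then an extremizer at $c_0$ exists. (2) Let $P$ be an extremizer at $c_0$. Then $P=u\,T_n$ with a constant $u\in\mathbb C$, $|u|=1$, and a polynomial $T_n$ such that $$T_n(e^{iz})=e^{inz/2}\cos\Big(\frac n2\,\theta(z)\Big),\qquad z\in\mathbb C_+=\{\operatorname{Im} z>0\},$$ where $\theta$ is a conformal mapping of $\mathbb C_+$ onto a periodic $n$-regular comb domain $$\Pi=\mathbb C_+\setminus\bigcup_{k=0}^{g}\bigcup_{m\in\mathbb Z}\{\omega_k+2\pi m+iy:\ 0<y\le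 h_k\},\qquad h_k>0,\quad \omega_k=\frac{2\pi j_k}{n},\quad j_k\in\mathbb Z,\ 0\le j_k<n,$$ with $0\le g<\infty$, distinct $j_0,\dots,j_g$ and $\omega_0=0$, normalized by $\theta(iy)\sim iy$ as $y\to+\infty$, and with the boundary values $\theta(a_0)=0-$, $\theta(b_0)=0+$: as $z\to a_0$ (respectively $z\to b_0$) within $\mathbb C_+$, $\theta(z)$ tends to $0$ with $\operatorname{Re}\theta(z)<0$ (respectively $\operatorname{Re}\theta(z)>0$) for $z$ close to $a_0$ (respectively $b_0$). Moreover, $T_n(e^{ic})=e^{inc/2}|T_n(e^{ic})|$ for all $c\in(a_0,b_0)$. Consequently the extremizer is unique up to a unimodular constant factor and does not depend on the position of the point in the gap: for every $c\in(a_0,b_0)$, the extremizers at $c$ are exactly the polynomials $v\,T_n$ with $v\in\mathbb C$, $|v|=1$. -/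

import Mathlib

open scoped Topology Asymptotics

namespace Remez

/-- The open upper half-plane, as a subset of the complex plane. -/
def upperHalf : Set ℂ := {z | 0 < z.im}

/-- The point of the unit circle with argument `x`. -/
noncomputable def circlePt (x : ℝ) : ℂ := Complex.exp (Complex.I * x)

/-- The class of complex polynomials of degree at most `n` bounded by one on `E`. -/
def boundedPolys (n : ℕ) (E : Set ℂ) : Set (Polynomial ℂ) :=
  {P | P.natDegree ≤ n ∧ ∀ ζ ∈ E, ‖P.eval ζ‖ ≤ 1}

/-- `P` maximizes the modulus at `exp (i c)` among the polynomials of degree at most `n` bounded by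
one on `E`. -/
def IsExtremizer (n : ℕ) (E : Set ℂ) (c : ℝ) (P : Polynomial ℂ) : Prop :=
  P ∈ boundedPolys n E ∧
    ∀ Q ∈ boundedPolys n E, ‖Q.eval (circlePt c)‖ ≤ ‖P.eval (circlePt c)‖

/-- The open arc `{exp (i x) : a < x < b}` is a gap of `E`: it does not meet `E`, while both of its
endpoints belong to `E` (in particular `b ≤ a + 2π`). -/
def IsGap (E : Set ℂ) (a b : ℝ) : Prop :=
  a < b ∧ circlePt a ∈ E ∧ circlePt b ∈ E ∧ ∀ x ∈ Set.Ioo a b, circlePt x ∉ E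

/-- The upper half-plane without the vertical slits of height `h k` over the points
`ω k + 2 π m`, `m ∈ ℤ`. -/
def combDomain {g : ℕ} (h ω : Fin (g + 1) → ℝ) : Set ℂ :=
  upperHalf \ ⋃ k : Fin (g + 1), ⋃ m : ℤ,
    {w : ℂ | w.re = ω k + 2 * Real.pi * m ∧ 0 < w.im ∧ w.im ≤ h k}

/-- `θ` is a conformal mapping (a holomorphic bijection) of `U` onto `V`. -/
def IsConformalOnto (θ : ℂ → ℂ) (U V : Set ℂ) : Prop :=
  DifferentiableOn ℂ θ U ∧ Set.BijOn θ U V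

/-- `θ` maps the upper half-plane conformally onto a periodic `n`-regular comb domain one of whose
slits (number `0`) stands over the origin, `θ (i y) ~ i y` as `y → ∞`, and in the sense of boundary
values `θ a = 0-`, `θ b = 0+`: as `z` tends to `a` (to `b`) within the upper half-plane, `θ z`
tends to the foot `0` of that slit from its left side (from its right side). -/
def IsCombMap (n : ℕ) (a b : ℝ) (θ : ℂ → ℂ) : Prop :=
  (∃ (g : ℕ) (h : Fin (g + 1) → ℝ) (j : Fin (g + 1) → ℕ),
    (∀ k, 0 < h k) ∧ (∀ k, j k < n) ∧ Function.Injective j ∧ j 0 = 0 ∧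
    IsConformalOnto θ upperHalf (combDomain h fun k => 2 * Real.pi * (j k : ℝ) / (n : ℝ))) ∧
  (fun y : ℝ => θ (Complex.I * y)) ~[Filter.atTop] (fun y : ℝ => Complex.I * (y : ℂ)) ∧
  Filter.Tendsto θ (𝓝[upperHalf] (a : ℂ)) (𝓝[{w : ℂ | w.re < 0}] 0) ∧
  Filter.Tendsto θ (𝓝[upperHalf] (b : ℂ)) (𝓝[{w : ℂ | 0 < w.re}] 0)

end Remez

namespace Remez
open Complex Filter Set Polynomial

/-! Substitute `ζ = exp (i z)` and study `t(z) = exp (-i n z / 2) T(exp (i z))` (`trig`), whose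
modulus on the real line is that of `T` on the circle. Rotating an extremizer so that its value at
`c₀` is nonnegative and taking the real part of `t` gives a real extremizer
(`IsExtremizer.exists_real`). By the Chebyshev argument this one takes the values `1` and `-1`
alternately at `n + 1` points of `E` on the arc complementary to the gap: otherwise a product of
half-angle sines, vanishing at `c₀` and with the sign of `t` where `|t| = 1`, would allow an
improvement (`IsExtremizer.exists_alternation`). Alternation does not refer to the point `c₀`.
Lagrange interpolation at the `n + 1` points, whose basis polynomials alternate in phase throughout
the gap, gives extremality and uniqueness at every `c` of the gap
(`isExtremizer_iff_of_alternation`).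

For the comb, `θ` has to be `(2/n) arccos t`. Counting zeros shows that the zeros of `t^2 - μ t'^2 -
τ^2`, for `μ ≥ 0` and `0 < τ ≤ 1`, are all real (`trig_sq_sub_ne`), so in the upper half-plane `t'^2
/ (1 - t^2)` avoids the closed negative half-axis. Its principal square root is a derivative of the
arccosine with positive real part (`exists_arccos_trig`); hence `θ` is injective and its image is
the region above the graph of a function `m ≥ 0` (`exists_image_eq_epigraph`). Since `t` is real on
the real line, `m` can be positive only over multiples of `2π/n`, so the region is a comb domain
(`isCombMap_of_cos`).

Existence is compactness: a polynomial of degree at most `n` is determined by its values at `n + 1`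
points of `E`. -/

lemma isOpen_upperHalf : IsOpen upperHalf := isOpen_lt continuous_const Complex.continuous_im

lemma convex_upperHalf : Convex ℝ upperHalf := convex_halfSpace_im_gt 0

lemma mk_mem_upperHalf {x y : ℝ} (hy : 0 < y) : (⟨x, y⟩ : ℂ) ∈ upperHalf := hy

lemma upperHalf_nhdsWithin_neBot (x : ℝ) : (𝓝[upperHalf] (x : ℂ)).NeBot := by
  rw [← mem_closure_iff_nhdsWithin_neBot]
  have h : Tendsto (fun k : ℕ => (⟨x, 1 / ((k : ℝ) + 1)⟩ : ℂ)) atTop (𝓝 (x : ℂ)) := by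
    have h1 : Tendsto (fun k : ℕ => (x : ℂ) + ((1 / ((k : ℝ) + 1) : ℝ) : ℂ) * I) atTop
        (𝓝 ((x : ℂ) + ((0 : ℝ) : ℂ) * I)) :=
      tendsto_const_nhds.add
        (((continuous_ofReal.tendsto _).comp tendsto_one_div_add_atTop_nhds_zero_nat).mul_const I)
    simp only [ofReal_zero, zero_mul, add_zero] at h1
    exact h1.congr fun k => (mk_eq_add_mul_I _ _).symm
  exact mem_closure_of_tendsto h (Eventually.of_forall fun k => mk_mem_upperHalf (by positivity))

/-! ### Univalence from a derivative with positive real part -/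

/-- A holomorphic function on a convex open set whose derivative has positive real part has
difference quotients with positive real part. -/
theorem re_mul_conj_pos {U : Set ℂ} (hU : IsOpen U) (hc : Convex ℝ U) {θ : ℂ → ℂ}
    (hθ : DifferentiableOn ℂ θ U) (hre : ∀ z ∈ U, 0 < (deriv θ z).re)
    {z w : ℂ} (hz : z ∈ U) (hw : w ∈ U) (hne : z ≠ w) :
    0 < ((θ w - θ z) * (starRingEnd ℂ) (w - z)).re := by
  set d := w - z with hd
  have hd0 : d ≠ 0 := sub_ne_zero.2 hne.symm
  have hmem : ∀ s ∈ Icc (0 : ℝ) 1, z + s * d ∈ U := by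
    intro s hs
    have := hc hz hw (sub_nonneg.2 hs.2) hs.1 (by ring)
    convert this using 1
    simp [hd]; ring
  -- Along the segment, `θ(z + s d) conj d` has derivative `θ' |d|^2`, of positive real part.
  have hder : ∀ s ∈ Icc (0 : ℝ) 1,
      HasDerivAt (fun s : ℝ => (θ (z + s * d) * (starRingEnd ℂ) d).re)
        ((deriv θ (z + s * d)).re * normSq d) s := by
    intro s hs
    have h1 : HasDerivAt θ (deriv θ (z + s * d)) (z + s * d) :=
      (hθ.differentiableAt (hU.mem_nhds (hmem s hs))).hasDerivAt
    have h2 : HasDerivAt (fun s : ℂ => z + s * d) d (s : ℂ) := by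
      simpa using ((hasDerivAt_id (s : ℂ)).mul_const d).const_add z
    have h3 := ((HasDerivAt.comp (s : ℂ) h1 h2).mul_const ((starRingEnd ℂ) d)).real_of_complex
    rw [mul_assoc, Complex.mul_conj, re_mul_ofReal] at h3
    exact h3
  have hmono : StrictMonoOn (fun s : ℝ => (θ (z + s * d) * (starRingEnd ℂ) d).re) (Icc 0 1) := by
    apply strictMonoOn_of_deriv_pos (convex_Icc 0 1)
    · exact fun s hs => (hder s hs).continuousAt.continuousWithinAt
    · intro s hs
      rw [interior_Icc] at hs
      have hs' := Ioo_subset_Icc_self hs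
      rw [(hder s hs').deriv]
      exact mul_pos (hre _ (hmem s hs')) (normSq_pos.2 hd0)
  have := hmono (left_mem_Icc.2 zero_le_one) (right_mem_Icc.2 zero_le_one) zero_lt_one
  simp only [ofReal_zero, zero_mul, add_zero, ofReal_one, one_mul] at this
  rw [sub_mul, sub_re]
  have e : z + d = w := by simp [hd]
  rw [e] at this
  linarith

/-! ### Level lines of the real part and the image as an epigraph -/

section Level

variable {θ : ℂ → ℂ}

/-- A quasi-periodic holomorphic map of the upper half-plane with `Re θ' > 0` takes the value `ξ` of
its real part exactly once on each horizontal line. -/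
theorem exists_level (hθ : DifferentiableOn ℂ θ upperHalf)
    (hper : ∀ z ∈ upperHalf, θ (z + 2 * Real.pi) = θ z + 2 * Real.pi) (ξ : ℝ) {y : ℝ} (hy : 0 < y) :
    ∃ x : ℝ, (θ ⟨x, y⟩).re = ξ := by
  have hcont : Continuous fun x : ℝ => (θ ⟨x, y⟩).re := by
    refine continuous_re.comp (hθ.continuousOn.comp_continuous ?_ fun x => mk_mem_upperHalf hy)
    have : (fun x : ℝ => (⟨x, y⟩ : ℂ)) = fun x : ℝ => (x : ℂ) + y * I := by
      ext x; exact mk_eq_add_mul_I _ _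
    rw [this]; fun_prop
  have hshift : ∀ (k : ℕ) (x : ℝ), (θ ⟨x + 2 * Real.pi * k, y⟩).re = (θ ⟨x, y⟩).re + 2 * Real.pi * k := by
    intro k
    induction k with
    | zero => intro x; simp
    | succ k ih =>
      intro x
      have e : (⟨x + 2 * Real.pi * (k + 1 : ℕ), y⟩ : ℂ) = ⟨x + 2 * Real.pi * k, y⟩ + 2 * Real.pi := by
        apply Complex.ext <;> simp; ring
      have h2 : (2 * (Real.pi : ℂ)).re = 2 * Real.pi := by simp
      rw [e, hper _ (mk_mem_upperHalf hy), add_re, ih, h2]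
      push_cast; ring
  obtain ⟨k, hk⟩ := exists_nat_gt (|ξ - (θ ⟨0, y⟩).re| / (2 * Real.pi))
  have hpi := Real.pi_pos
  rw [div_lt_iff₀ (by positivity)] at hk
  have hlo : (θ ⟨-(2 * Real.pi * k), y⟩).re ≤ ξ := by
    have := hshift k (-(2 * Real.pi * k))
    rw [neg_add_cancel] at this
    have := neg_abs_le (ξ - (θ ⟨0, y⟩).re)
    nlinarith
  have hhi : ξ ≤ (θ ⟨2 * Real.pi * k, y⟩).re := by
    have := hshift k 0
    rw [zero_add] at this
    have := le_abs_self (ξ - (θ ⟨0, y⟩).re)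
    nlinarith
  obtain ⟨x, -, hx⟩ := intermediate_value_Icc
    (show -(2 * Real.pi * k) ≤ 2 * Real.pi * k by
      have : 0 ≤ 2 * Real.pi * k := by positivity
      linarith) hcont.continuousOn ⟨hlo, hhi⟩
  exact ⟨x, hx⟩

variable (hθ : DifferentiableOn ℂ θ upperHalf) (hre : ∀ z ∈ upperHalf, 0 < (deriv θ z).re)

include hθ hre

theorem injOn_of_re_deriv_pos : InjOn θ upperHalf := by
  intro z hz w hw h
  by_contra hne
  have := re_mul_conj_pos isOpen_upperHalf convex_upperHalf hθ hre hz hw hne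
  simp [h] at this

theorem re_lt_re_of_lt {y x x' : ℝ} (hy : 0 < y) (hx : x < x') :
    (θ ⟨x, y⟩).re < (θ ⟨x', y⟩).re := by
  have hne : (⟨x, y⟩ : ℂ) ≠ ⟨x', y⟩ := by
    intro h; exact hx.ne (congrArg re h)
  have := re_mul_conj_pos isOpen_upperHalf convex_upperHalf hθ hre (mk_mem_upperHalf hy)
    (mk_mem_upperHalf hy) hne
  simp at this
  nlinarith [sub_pos.2 hx]

/-- When the real parts of the values agree, `Re ((θ w - θ z) conj (w - z))` is the product of the
two differences of imaginary parts, and it is positive. -/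
theorem im_lt_im_of_re_eq {z w : ℂ} (hz : z ∈ upperHalf) (hw : w ∈ upperHalf)
    (h : (θ z).re = (θ w).re) (hzw : z.im < w.im) : (θ z).im < (θ w).im := by
  have hne : z ≠ w := by rintro rfl; exact hzw.ne rfl
  have := re_mul_conj_pos isOpen_upperHalf convex_upperHalf hθ hre hz hw hne
  simp [h] at this
  nlinarith [sub_pos.2 hzw]

/-- Strict monotonicity on horizontal lines turns `x < X y` into `Re θ(x + i y) < ξ`, which for
fixed `x` is an open condition on `y`; likewise on the other side. -/
theorem continuousOn_level {X : ℝ → ℝ} {ξ : ℝ} (hX : ∀ y, 0 < y → (θ ⟨X y, y⟩).re = ξ) :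
    ContinuousOn X (Ioi 0) := by
  have hcv : ∀ x y : ℝ, 0 < y → ContinuousAt (fun y : ℝ => (θ ⟨x, y⟩).re) y := by
    intro x y hy
    have h1 : ContinuousAt θ ⟨x, y⟩ :=
      (hθ.differentiableAt (isOpen_upperHalf.mem_nhds (mk_mem_upperHalf hy))).continuousAt
    have h2 : ContinuousAt (fun y : ℝ => (⟨x, y⟩ : ℂ)) y := by
      have : (fun y : ℝ => (⟨x, y⟩ : ℂ)) = fun y : ℝ => (x : ℂ) + y * I := by
        ext y; apply Complex.ext <;> simp
      rw [this]; fun_prop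
    exact continuous_re.continuousAt.comp (ContinuousAt.comp (f := fun y : ℝ => (⟨x, y⟩ : ℂ)) h1 h2)
  have hle : ∀ y, 0 < y → ∀ x, ((θ ⟨x, y⟩).re < ξ ↔ x < X y) ∧ (ξ < (θ ⟨x, y⟩).re ↔ X y < x) := by
    intro y hy x
    rcases lt_trichotomy x (X y) with h | h | h
    · have := re_lt_re_of_lt hθ hre hy h
      rw [hX y hy] at this
      exact ⟨iff_of_true this h, iff_of_false this.not_gt h.not_gt⟩
    · rw [h, hX y hy]; simp
    · have := re_lt_re_of_lt hθ hre hy h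
      rw [hX y hy] at this
      exact ⟨iff_of_false this.not_gt h.not_gt, iff_of_true this h⟩
  intro y hy
  apply ContinuousAt.continuousWithinAt
  rw [ContinuousAt, tendsto_order]
  have hpos : ∀ᶠ y' in 𝓝 y, 0 < y' := lt_mem_nhds hy
  constructor
  · intro a ha
    filter_upwards [hpos, (hcv a y hy).eventually (gt_mem_nhds (((hle y hy a).1).2 ha))] with y' h1 h2
    exact ((hle y' h1 a).1).1 h2
  · intro a ha
    filter_upwards [hpos, (hcv a y hy).eventually (lt_mem_nhds (((hle y hy a).2).2 ha))] with y' h1 h2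
    exact ((hle y' h1 a).2).1 h2

end Level

/-- The image of a quasi-periodic holomorphic map of the upper half-plane with `Re θ' > 0` is the
region above a graph, whose points are boundary values of the map. -/
theorem exists_image_eq_epigraph {θ : ℂ → ℂ} (hθ : DifferentiableOn ℂ θ upperHalf)
    (hre : ∀ z ∈ upperHalf, 0 < (deriv θ z).re)
    (hper : ∀ z ∈ upperHalf, θ (z + 2 * Real.pi) = θ z + 2 * Real.pi)
    (him : ∀ z ∈ upperHalf, 0 < (θ z).im)
    (hinf : ∃ C Y : ℝ, ∀ z : ℂ, Y < z.im → ‖θ z - z‖ ≤ C)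
    {a : ℝ} (ha : Tendsto θ (𝓝[upperHalf] (a : ℂ)) (𝓝 0)) :
    ∃ m : ℝ → ℝ, (∀ ξ, 0 ≤ m ξ) ∧ (∀ w : ℂ, w ∈ θ '' upperHalf ↔ m w.re < w.im) ∧
      ∀ ξ, ∃ (p : ℕ → ℂ) (x : ℝ), (∀ k, p k ∈ upperHalf ∧ (θ (p k)).re = ξ) ∧
        Tendsto p atTop (𝓝 (x : ℂ)) ∧ Tendsto (fun k => θ (p k)) atTop (𝓝 ⟨ξ, m ξ⟩) := by
  -- `X ξ` parametrizes the level line `Re θ = ξ` by height, and `s ξ` is `Im θ` along it. It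
  -- increases continuously to infinity, so the image meets the vertical line over `ξ` in an open
  -- ray; `m ξ` is its lower end.
  choose! X hX using fun (ξ y : ℝ) (hy : 0 < y) => exists_level hθ hper ξ hy
  set s : ℝ → ℝ → ℝ := fun ξ y => (θ ⟨X ξ y, y⟩).im with hs
  have hmono : ∀ ξ, StrictMonoOn (s ξ) (Ioi 0) := by
    intro ξ y hy y' hy' h
    exact im_lt_im_of_re_eq hθ hre (mk_mem_upperHalf hy) (mk_mem_upperHalf hy')
      ((hX ξ y hy).trans (hX ξ y' hy').symm) h
  have hcont : ∀ ξ, ContinuousOn (s ξ) (Ioi 0) := by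
    intro ξ
    refine continuous_im.comp_continuousOn (hθ.continuousOn.comp ?_ fun y hy => mk_mem_upperHalf hy)
    have : (fun y : ℝ => (⟨X ξ y, y⟩ : ℂ)) = fun y : ℝ => ((X ξ y : ℝ) : ℂ) + y * I := by
      ext y; apply Complex.ext <;> simp
    rw [this]
    exact (continuous_ofReal.comp_continuousOn (continuousOn_level hθ hre (hX ξ))).add
      (by fun_prop)
  have htop : ∀ ξ M, ∃ y, 0 < y ∧ M < s ξ y := by
    intro ξ M
    obtain ⟨C, Y, hCY⟩ := hinf
    refine ⟨max (max (Y + 1) 1) (M + C + 1), by positivity, ?_⟩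
    set y := max (max (Y + 1) 1) (M + C + 1)
    have h1 : Y + 1 ≤ y := (le_max_left _ _).trans (le_max_left _ _)
    have h2 : M + C + 1 ≤ y := le_max_right _ _
    have h3 := (abs_im_le_norm _).trans (hCY ⟨X ξ y, y⟩ (by simp; linarith))
    simp only [sub_im] at h3
    have := (abs_le.1 h3).1
    simp only [hs]; linarith
  have hbdd : ∀ ξ, BddBelow (s ξ '' Ioi 0) := fun ξ =>
    ⟨0, by rintro _ ⟨y, hy, rfl⟩; exact (him _ (mk_mem_upperHalf hy)).le⟩
  have hne : ∀ ξ, (s ξ '' Ioi 0).Nonempty := fun ξ => ⟨_, 1, mem_Ioi.2 one_pos, rfl⟩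
  set m : ℝ → ℝ := fun ξ => sInf (s ξ '' Ioi 0) with hm
  have hlt : ∀ ξ y, 0 < y → m ξ < s ξ y := by
    intro ξ y hy
    have h1 : s ξ (y / 2) < s ξ y := hmono ξ (half_pos hy) hy (half_lt_self hy)
    exact (csInf_le (hbdd ξ) ⟨y / 2, half_pos hy, rfl⟩).trans_lt h1
  refine ⟨m, fun ξ => le_csInf (hne ξ) ?_, ?_, ?_⟩
  · rintro _ ⟨y, hy, rfl⟩; exact (him _ (mk_mem_upperHalf hy)).le
  · intro w
    constructor
    · rintro ⟨z, hz, rfl⟩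
      set ξ := (θ z).re with hξ
      have hzX : z = ⟨X ξ z.im, z.im⟩ := by
        by_contra hne
        have hx : z.re ≠ X ξ z.im := fun h => hne (Complex.ext h rfl)
        have hX' := hX ξ z.im hz
        rcases lt_or_gt_of_ne hx with h | h
        · have := re_lt_re_of_lt hθ hre hz h
          rw [hX'] at this; exact this.ne hξ.symm
        · have := re_lt_re_of_lt hθ hre hz h
          rw [hX'] at this; exact this.ne hξ
      have := hlt ξ z.im hz
      simp only [hs] at this
      rwa [← hzX] at this
    · intro hw
      obtain ⟨_, ⟨y₁, hy₁, rfl⟩, h1⟩ := exists_lt_of_csInf_lt (hne w.re) hw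
      obtain ⟨y₂, hy₂, h2⟩ := htop w.re w.im
      have h12 : y₁ < y₂ := by
        by_contra hcon
        have := (hmono w.re).monotoneOn hy₂ hy₁ (not_lt.1 hcon)
        linarith
      obtain ⟨y, hy, hyw⟩ := intermediate_value_Icc h12.le
        ((hcont w.re).mono fun y hy => lt_of_lt_of_le hy₁ hy.1) ⟨h1.le, h2.le⟩
      have hy0 : 0 < y := lt_of_lt_of_le hy₁ hy.1
      exact ⟨⟨X w.re y, y⟩, mk_mem_upperHalf hy0, Complex.ext (hX _ _ hy0) hyw⟩
  · intro ξ
    have hpi := Real.pi_pos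
    have hshift : ∀ (k : ℕ) (z : ℂ), z ∈ upperHalf →
        θ (z + 2 * Real.pi * k) = θ z + 2 * Real.pi * k := by
      intro k
      induction k with
      | zero => intro z _; simp
      | succ k ih =>
        intro z hz
        have hz' : z + 2 * Real.pi * k ∈ upperHalf := by
          have : z.im > 0 := hz
          simpa [upperHalf] using this
        have := hper _ hz'
        rw [ih z hz] at this
        rw [show z + 2 * Real.pi * ((k + 1 : ℕ) : ℂ) = z + 2 * Real.pi * k + 2 * Real.pi by
          push_cast; ring, this]
        push_cast; ring
    -- `N` periods move `Re θ` near `a`, which is less than `1` in modulus, past `ξ` on both sides.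
    -- By monotonicity the level line is then confined between `a - 2πN` and `a + 2πN` at small
    -- heights, and compactness gives a limit point on the real line.
    obtain ⟨N, hN⟩ := exists_nat_gt ((|ξ| + 1) / (2 * Real.pi))
    rw [div_lt_iff₀ (by positivity)] at hN
    set yk : ℕ → ℝ := fun k => 1 / ((k : ℝ) + 1) with hyk
    have hyk0 : ∀ k, 0 < yk k := fun k => by positivity
    have hykt : Tendsto yk atTop (𝓝 0) := tendsto_one_div_add_atTop_nhds_zero_nat
    have hak : Tendsto (fun k => (⟨a, yk k⟩ : ℂ)) atTop (𝓝[upperHalf] (a : ℂ)) := by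
      refine tendsto_nhdsWithin_iff.2 ⟨?_, Eventually.of_forall fun k => mk_mem_upperHalf (hyk0 k)⟩
      have h1 : Tendsto (fun k : ℕ => (a : ℂ) + ((yk k : ℝ) : ℂ) * I) atTop
          (𝓝 ((a : ℂ) + ((0 : ℝ) : ℂ) * I)) :=
        tendsto_const_nhds.add (((continuous_ofReal.tendsto _).comp hykt).mul_const I)
      simp only [ofReal_zero, zero_mul, add_zero] at h1
      exact h1.congr fun k => (mk_eq_add_mul_I _ _).symm
    have hsmall : ∀ᶠ k in atTop, |(θ ⟨a, yk k⟩).re| < 1 := by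
      have h1 : Tendsto (fun k => |(θ ⟨a, yk k⟩).re|) atTop (𝓝 |(0 : ℂ).re|) :=
        ((continuous_re.tendsto _).comp (ha.comp hak)).abs
      exact h1.eventually (gt_mem_nhds (by simp))
    have hmem : ∀ᶠ k in atTop, X ξ (yk k) ∈ Icc (a - 2 * Real.pi * N) (a + 2 * Real.pi * N) := by
      filter_upwards [hsmall] with k hk
      have hXk := hX ξ (yk k) (hyk0 k)
      have hξ := abs_le.1 (le_refl |ξ|)
      have hk' := abs_lt.1 hk
      have hre2 : (2 * (Real.pi : ℂ) * N).re = 2 * Real.pi * N := by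
        have : (2 * (Real.pi : ℂ) * N) = ((2 * Real.pi * N : ℝ) : ℂ) := by push_cast; ring
        rw [this, ofReal_re]
      constructor
      · by_contra hcon
        have h1 := re_lt_re_of_lt hθ hre (hyk0 k) (not_le.1 hcon)
        have h2 := hshift N ⟨a - 2 * Real.pi * N, yk k⟩ (mk_mem_upperHalf (hyk0 k))
        have e : (⟨a - 2 * Real.pi * N, yk k⟩ : ℂ) + 2 * Real.pi * N = ⟨a, yk k⟩ := by
          apply Complex.ext
          · rw [add_re, hre2]; ring
          · simp
        rw [e] at h2
        have h3 := congrArg re h2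
        rw [add_re, hre2] at h3
        linarith [hξ.1]
      · by_contra hcon
        have h1 := re_lt_re_of_lt hθ hre (hyk0 k) (not_le.1 hcon)
        have h2 := hshift N ⟨a, yk k⟩ (mk_mem_upperHalf (hyk0 k))
        have e : (⟨a, yk k⟩ : ℂ) + 2 * Real.pi * N = ⟨a + 2 * Real.pi * N, yk k⟩ := by
          apply Complex.ext
          · rw [add_re, hre2]
          · simp
        rw [e] at h2
        have h3 := congrArg re h2
        rw [add_re, hre2] at h3
        linarith [hξ.2]
    obtain ⟨x, -, φ, hφ, hφx⟩ := isCompact_Icc.tendsto_subseq' hmem.frequently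
    have hyφ := hykt.comp hφ.tendsto_atTop
    refine ⟨fun k => ⟨X ξ (yk (φ k)), yk (φ k)⟩, x, fun k => ⟨mk_mem_upperHalf (hyk0 _),
      hX _ _ (hyk0 _)⟩, ?_, ?_⟩
    · have h1 := ((continuous_ofReal.tendsto _).comp hφx).add
        (((continuous_ofReal.tendsto _).comp hyφ).mul_const I)
      simp only [ofReal_zero, zero_mul, add_zero] at h1
      exact h1.congr fun k => (mk_eq_add_mul_I _ _).symm
    · have hst : Tendsto (fun k => s ξ (yk (φ k))) atTop (𝓝 (m ξ)) := by
        rw [tendsto_order]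
        refine ⟨fun b hb => Eventually.of_forall fun k => hb.trans (hlt ξ _ (hyk0 _)), ?_⟩
        intro b hb
        obtain ⟨_, ⟨y₁, hy₁, rfl⟩, h1⟩ := exists_lt_of_csInf_lt (hne ξ) hb
        filter_upwards [hyφ.eventually (gt_mem_nhds hy₁)] with k hk
        exact (hmono ξ (hyk0 _) hy₁ hk).trans h1
      have h1 := (tendsto_const_nhds (x := (ξ : ℂ))).add
        (((continuous_ofReal.tendsto _).comp hst).mul_const I)
      have e : (⟨ξ, m ξ⟩ : ℂ) = (ξ : ℂ) + ((m ξ : ℝ) : ℂ) * I := by apply Complex.ext <;> simp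
      rw [e]
      refine h1.congr fun k => ?_
      apply Complex.ext
      · simp [hX ξ _ (hyk0 (φ k))]
      · simp [hs]

theorem isEquivalent_of_norm_sub_le {θ : ℂ → ℂ}
    (hinf : ∃ C Y : ℝ, ∀ z : ℂ, Y < z.im → ‖θ z - z‖ ≤ C) :
    (fun y : ℝ => θ (I * y)) ~[atTop] (fun y : ℝ => I * (y : ℂ)) := by
  obtain ⟨C, Y, hCY⟩ := hinf
  have h1 : (fun y : ℝ => θ (I * y) - I * y) =O[atTop] (fun _ => (1 : ℝ)) := by
    refine Asymptotics.IsBigO.of_bound C ?_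
    filter_upwards [eventually_gt_atTop Y] with y hy
    simpa using hCY (I * y) (by simpa using hy)
  have h2 : (fun _ : ℝ => (1 : ℝ)) =o[atTop] (fun y : ℝ => I * (y : ℂ)) := by
    rw [Asymptotics.isLittleO_const_left]
    right
    have : (norm ∘ fun y : ℝ => I * (y : ℂ)) = fun y : ℝ => |y| := by ext y; simp
    rw [this]
    exact tendsto_abs_atTop_atTop
  exact h1.trans_isLittleO h2

lemma tendsto_mk_nhdsWithin {α : Type*} {l : Filter α} {u v : α → ℝ} {x : ℝ}
    (hu : Tendsto u l (𝓝 x)) (hv : Tendsto v l (𝓝 0)) (hv0 : ∀ k, 0 < v k) :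
    Tendsto (fun k => (⟨u k, v k⟩ : ℂ)) l (𝓝[upperHalf] (x : ℂ)) := by
  refine tendsto_nhdsWithin_iff.2 ⟨?_, Eventually.of_forall fun k => mk_mem_upperHalf (hv0 k)⟩
  have h1 := ((continuous_ofReal.tendsto _).comp hu).add
    (((continuous_ofReal.tendsto _).comp hv).mul_const I)
  simp only [ofReal_zero, zero_mul, add_zero] at h1
  exact h1.congr fun k => (mk_eq_add_mul_I _ _).symm

/-! ### Recognizing a comb domain -/

/-- Limit points on the real line of a level curve of the real part lie strictly between boundary
points at which the real part is smaller and larger. -/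
theorem lim_level_mem_Ioo {θ : ℂ → ℂ} (hθ : DifferentiableOn ℂ θ upperHalf)
    (hre : ∀ z ∈ upperHalf, 0 < (deriv θ z).re) {a b ξ x : ℝ}
    (ha : ∀ᶠ z in 𝓝[upperHalf] (a : ℂ), (θ z).re < ξ)
    (hb : ∀ᶠ z in 𝓝[upperHalf] (b : ℂ), ξ < (θ z).re)
    {p : ℕ → ℂ} (hp : ∀ k, p k ∈ upperHalf ∧ (θ (p k)).re = ξ)
    (hpx : Tendsto p atTop (𝓝 (x : ℂ))) : x ∈ Ioo a b := by
  have hpre : Tendsto (fun k => (p k).re) atTop (𝓝 x) := (continuous_re.tendsto _).comp hpx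
  have hpim : Tendsto (fun k => (p k).im) atTop (𝓝 0) := (continuous_im.tendsto _).comp hpx
  have hmono : ∀ (y x x' : ℝ), 0 < y → x ≤ x' → (θ ⟨x, y⟩).re ≤ (θ ⟨x', y⟩).re := by
    intro y x x' hy h
    rcases h.eq_or_lt with rfl | h
    · exact le_rfl
    · exact (re_lt_re_of_lt hθ hre hy h).le
  constructor
  · by_contra hcon
    -- Moving `p k` right to abscissa `max (Re p k) a` does not decrease `Re θ`, but if `x ≤ a` the
    -- moved points tend to `a`, where `Re θ < ξ`.
    have h1 : Tendsto (fun k => max (p k).re a) atTop (𝓝 a) := by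
      have := hpre.max (tendsto_const_nhds (x := a))
      rwa [max_eq_right (not_lt.1 hcon)] at this
    obtain ⟨k, hk⟩ := ((tendsto_mk_nhdsWithin h1 hpim fun k => (hp k).1).eventually ha).exists
    have h2 := hmono _ _ _ (hp k).1 (le_max_left (p k).re a)
    have h3 := (hp k).2
    linarith
  · by_contra hcon
    have h1 : Tendsto (fun k => min (p k).re b) atTop (𝓝 b) := by
      have := hpre.min (tendsto_const_nhds (x := b))
      rwa [min_eq_right (not_lt.1 hcon)] at this
    obtain ⟨k, hk⟩ := ((tendsto_mk_nhdsWithin h1 hpim fun k => (hp k).1).eventually hb).exists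
    have h2 := hmono _ _ _ (hp k).1 (min_le_left (p k).re b)
    have h3 := (hp k).2
    linarith

lemma cos_eq_zero_im {x y : ℝ} (h : (Complex.cos (⟨x, y⟩ : ℂ)).im = 0) : Real.sin x = 0 ∨ y = 0 := by
  rw [mk_eq_add_mul_I, Complex.cos_add_mul_I, ← ofReal_cos, ← ofReal_sin, ← ofReal_cosh,
    ← ofReal_sinh] at h
  rw [← ofReal_mul, ← ofReal_mul, sub_im, ofReal_im, im_ofReal_mul, I_im, mul_one, zero_sub,
    neg_eq_zero, mul_eq_zero, Real.sinh_eq_zero] at h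
  exact h

/-- The image lies above the graph of `m`, and in the limit at a real point `cos ((n/2)(ξ + i m ξ))`
is a value of `t` there, hence real. As `Im cos (x + i y) = -sin x sinh y`, either `m ξ = 0` or `ξ`
is a multiple of `2π/n`. Periodicity of `m` leaves finitely many slits up to translation. -/
theorem isCombMap_of_cos {n : ℕ} (hn : 1 ≤ n) {a b : ℝ} {t θ : ℂ → ℂ}
    (htc : Continuous t) (htr : ∀ x : ℝ, (t x).im = 0) (ht1 : ∀ x ∈ Ioo a b, 1 < (t x).re)
    (hcos : ∀ z ∈ upperHalf, t z = Complex.cos ((n : ℂ) / 2 * θ z))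
    (hθ : DifferentiableOn ℂ θ upperHalf)
    (hre : ∀ z ∈ upperHalf, 0 < (deriv θ z).re)
    (hper : ∀ z ∈ upperHalf, θ (z + 2 * Real.pi) = θ z + 2 * Real.pi)
    (him : ∀ z ∈ upperHalf, 0 < (θ z).im)
    (hinf : ∃ C Y : ℝ, ∀ z : ℂ, Y < z.im → ‖θ z - z‖ ≤ C)
    (ha : Tendsto θ (𝓝[upperHalf] (a : ℂ)) (𝓝[{w : ℂ | w.re < 0}] 0))
    (hb : Tendsto θ (𝓝[upperHalf] (b : ℂ)) (𝓝[{w : ℂ | 0 < w.re}] 0)) :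
    IsCombMap n a b θ := by
  obtain ⟨m, hm0, hmim, hmlim⟩ := exists_image_eq_epigraph hθ hre hper him hinf
    (tendsto_nhdsWithin_iff.1 ha).1
  have hn0 : (0 : ℝ) < n := by exact_mod_cast hn
  have hpi := Real.pi_pos
  have hinj := injOn_of_re_deriv_pos hθ hre
  have hlimcos : ∀ ξ, ∃ (p : ℕ → ℂ) (x : ℝ), (∀ k, p k ∈ upperHalf ∧ (θ (p k)).re = ξ) ∧
      Tendsto p atTop (𝓝 (x : ℂ)) ∧ t x = Complex.cos (⟨n / 2 * ξ, n / 2 * m ξ⟩ : ℂ) := by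
    intro ξ
    obtain ⟨p, x, hp, hpx, hpθ⟩ := hmlim ξ
    refine ⟨p, x, hp, hpx, ?_⟩
    have h1 := (htc.tendsto _).comp hpx
    have h2 : Tendsto (fun k => Complex.cos ((n : ℂ) / 2 * θ (p k))) atTop
        (𝓝 (Complex.cos ((n : ℂ) / 2 * ⟨ξ, m ξ⟩))) :=
      (Complex.continuous_cos.tendsto _).comp (hpθ.const_mul _)
    have h3 := tendsto_nhds_unique h1 (h2.congr fun k => (hcos _ (hp k).1).symm)
    rw [h3]
    congr 1
    have e : (n : ℂ) / 2 = ((n / 2 : ℝ) : ℂ) := by push_cast; rfl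
    rw [e]
    apply Complex.ext <;> simp
  have hmzero : ∀ ξ, Real.sin (n / 2 * ξ) ≠ 0 → m ξ = 0 := by
    intro ξ hξ
    obtain ⟨p, x, -, -, hx⟩ := hlimcos ξ
    have h1 := htr x
    rw [hx] at h1
    rcases cos_eq_zero_im h1 with h | h
    · exact absurd h hξ
    · rcases mul_eq_zero.1 h with h | h
      · linarith
      · exact h
  -- The level line over `0` ends strictly inside the gap, where `t > 1`; height `0` would give `t =
  -- cos 0 = 1` there.
  have hmpos : 0 < m 0 := by
    refine lt_of_le_of_ne (hm0 0) fun h0 => ?_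
    obtain ⟨p, x, hp, hpx, hx⟩ := hlimcos 0
    have hx1 : t x = 1 := by
      rw [hx, ← h0, mul_zero]
      exact Complex.cos_zero
    have key : x ∈ Ioo a b := lim_level_mem_Ioo hθ hre
      (ha.eventually self_mem_nhdsWithin) (hb.eventually self_mem_nhdsWithin) hp hpx
    have := ht1 x key
    rw [hx1] at this
    simp at this
  have hmper : ∀ ξ, m (ξ + 2 * Real.pi) = m ξ := by
    have himg : ∀ w, w ∈ θ '' upperHalf ↔ w + 2 * Real.pi ∈ θ '' upperHalf := by
      intro w
      constructor
      · rintro ⟨z, hz, rfl⟩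
        refine ⟨z + 2 * Real.pi, ?_, hper z hz⟩
        have : 0 < z.im := hz
        simpa [upperHalf] using this
      · rintro ⟨z, hz, h⟩
        have hz' : z - 2 * Real.pi ∈ upperHalf := by
          have : 0 < z.im := hz
          simpa [upperHalf] using this
        refine ⟨z - 2 * Real.pi, hz', ?_⟩
        have h2 := hper _ hz'
        rw [sub_add_cancel, h] at h2
        exact (add_right_cancel h2).symm
    have hiff : ∀ ξ s, m ξ < s ↔ m (ξ + 2 * Real.pi) < s := by
      intro ξ s
      have := himg ⟨ξ, s⟩
      rw [hmim, hmim] at this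
      simpa using this
    intro ξ
    apply le_antisymm
    · exact le_of_forall_gt fun s hs => (hiff ξ s).1 hs
    · exact le_of_forall_gt fun s hs => (hiff ξ s).2 hs
  have hmperZ : ∀ (q : ℤ) ξ, m (ξ + 2 * Real.pi * q) = m ξ := by
    have hp : Function.Periodic m (2 * Real.pi) := hmper
    intro q ξ
    have := hp.int_mul q ξ
    rwa [mul_comm] at this
  refine ⟨?_, isEquivalent_of_norm_sub_le hinf, ha, hb⟩
  -- Only residues carrying a slit of positive height are kept. Their increasing enumeration puts
  -- `0`, which belongs to `J`, at index `0`.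
  set J : Finset ℕ := (Finset.range n).filter fun j => 0 < m (2 * Real.pi * j / n) with hJ
  have h0J : 0 ∈ J := by simp [hJ, hmpos]; omega
  obtain ⟨g, hg⟩ : ∃ g, J.card = g + 1 :=
    ⟨J.card - 1, by have := Finset.card_pos.2 ⟨0, h0J⟩; omega⟩
  have hjm : ∀ k, J.orderEmbOfFin hg k ∈ J := fun k => Finset.orderEmbOfFin_mem _ _ _
  refine ⟨g, fun k => m (2 * Real.pi * (J.orderEmbOfFin hg k : ℕ) / n), fun k => J.orderEmbOfFin hg k,
    fun k => (Finset.mem_filter.1 (hjm k)).2, fun k => Finset.mem_range.1 (Finset.mem_filter.1 (hjm k)).1,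
    (J.orderEmbOfFin hg).injective, ?_, hθ, ?_⟩
  · have h1 : (J.orderEmbOfFin hg 0 : ℕ) = J.min' ⟨0, h0J⟩ := Finset.orderEmbOfFin_zero hg (by omega)
    exact h1.trans (Nat.le_zero.1 (J.min'_le 0 h0J))
  · have himage : θ '' upperHalf = combDomain
        (fun k => m (2 * Real.pi * (J.orderEmbOfFin hg k : ℕ) / n))
        (fun k => 2 * Real.pi * ((J.orderEmbOfFin hg k : ℕ) : ℝ) / (n : ℝ)) := by
      ext w
      rw [hmim]
      simp only [combDomain, Set.mem_sdiff, mem_iUnion, mem_ofPred_eq, not_exists, upperHalf]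
      constructor
      · intro hw
        refine ⟨(hm0 _).trans_lt hw, fun k q hcon => ?_⟩
        rw [hcon.1, hmperZ] at hw
        exact hcon.2.2.not_gt hw
      · rintro ⟨hw0, hw⟩
        by_cases hs : Real.sin (n / 2 * w.re) = 0
        · obtain ⟨q, hq⟩ := Real.sin_eq_zero_iff.1 hs
          have hnZ : (0 : ℤ) < n := by exact_mod_cast hn
          obtain ⟨j, hj⟩ := Int.eq_ofNat_of_zero_le (Int.emod_nonneg q hnZ.ne')
          have hjn : j < n := by
            have := Int.emod_lt_of_pos q hnZ
            omega
          have hwre : w.re = 2 * Real.pi * j / n + 2 * Real.pi * (q / n : ℤ) := by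
            have h1 : (q : ℝ) = n * ((q / n : ℤ) : ℝ) + j := by
              have := Int.mul_ediv_add_emod q n
              rw [hj] at this
              exact_mod_cast this.symm
            have h2 : w.re = 2 * q * Real.pi / n := by field_simp at hq ⊢; linarith
            rw [h2, h1]; field_simp; ring
          rw [hwre, hmperZ]
          by_cases hjJ : j ∈ J
          · obtain ⟨k, hk⟩ : j ∈ range (J.orderEmbOfFin hg) := by
              rw [Finset.range_orderEmbOfFin]; exact hjJ
            have := hw k (q / n)
            rw [hk] at this
            by_contra hcon
            exact this ⟨hwre, hw0, not_lt.1 hcon⟩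
          · have : ¬ 0 < m (2 * Real.pi * j / n) := fun h =>
              hjJ (Finset.mem_filter.2 ⟨Finset.mem_range.2 hjn, h⟩)
            exact (not_lt.1 this).trans_lt hw0
        · rw [hmzero _ hs]; exact hw0
    rw [← himage]
    exact hinj.bijOn_image

/-! ### Trigonometric functions of half-integer or integer frequency -/

/-- The trigonometric function `exp (-i n z / 2) T (exp (i z))`. -/
noncomputable def trig (n : ℕ) (T : ℂ[X]) (z : ℂ) : ℂ := exp (-(I * n * z / 2)) * T.eval (exp (I * z))

/-- The polynomial of the derivative of `trig n T`. -/
noncomputable def trigDeriv (n : ℕ) (T : ℂ[X]) : ℂ[X] :=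
  C I * (X * derivative T - C ((n : ℂ) / 2) * T)

lemma hasDerivAt_trig (n : ℕ) (T : ℂ[X]) (z : ℂ) :
    HasDerivAt (trig n T) (trig n (trigDeriv n T) z) z := by
  have h1 : HasDerivAt (fun z : ℂ => exp (I * z)) (exp (I * z) * I) z := by
    simpa using ((hasDerivAt_id z).const_mul I).cexp
  have h2 : HasDerivAt (fun z : ℂ => exp (-(I * n * z / 2))) (exp (-(I * n * z / 2)) * -(I * n / 2)) z := by
    simpa using ((((hasDerivAt_id z).const_mul (I * n)).div_const 2).neg).cexp
  have h3 := h2.mul ((T.hasDerivAt _).comp z h1)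
  refine h3.congr_deriv ?_
  simp [trig, trigDeriv]
  ring

lemma differentiable_trig (n : ℕ) (T : ℂ[X]) : Differentiable ℂ (trig n T) :=
  fun z => (hasDerivAt_trig n T z).differentiableAt

lemma continuous_trig (n : ℕ) (T : ℂ[X]) : Continuous (trig n T) := (differentiable_trig n T).continuous

lemma exp_mul_trig (n : ℕ) (T : ℂ[X]) (z : ℂ) :
    exp (I * n * z / 2) * trig n T z = T.eval (exp (I * z)) := by
  rw [trig, ← mul_assoc, ← exp_add, add_neg_cancel, exp_zero, one_mul]

lemma trig_add_two_pi (n : ℕ) (T : ℂ[X]) (z : ℂ) :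
    trig n T (z + 2 * Real.pi) = (-1) ^ n * trig n T z := by
  have h1 : exp (I * (z + 2 * Real.pi)) = exp (I * z) := by
    rw [show I * (z + 2 * Real.pi) = I * z + 2 * Real.pi * I by ring, exp_add, exp_two_pi_mul_I, mul_one]
  have h2 : exp (-(I * n * (z + 2 * Real.pi) / 2)) = (-1) ^ n * exp (-(I * n * z / 2)) := by
    rw [show -(I * n * (z + 2 * Real.pi) / 2) = n * (-(Real.pi * I)) + -(I * n * z / 2) by ring, exp_add,
      exp_nat_mul, exp_neg, exp_pi_mul_I]
    norm_num
  rw [trig, h1, h2, trig, mul_assoc]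

lemma natDegree_trigDeriv_le {n : ℕ} {T : ℂ[X]} (hT : T.natDegree ≤ n) :
    (trigDeriv n T).natDegree ≤ n := by
  refine (natDegree_C_mul_le _ _).trans ((natDegree_sub_le _ _).trans (max_le ?_ ?_))
  · by_cases h : derivative T = 0
    · simp [h]
    · refine natDegree_mul_le.trans ?_
      have h1 : T.natDegree ≠ 0 := fun h0 => h (by
        rw [eq_C_of_natDegree_eq_zero h0, derivative_C])
      have h2 := natDegree_derivative_lt h1
      rw [natDegree_X]
      omega
  · exact (natDegree_C_mul_le _ _).trans hT

lemma eval_zero_trigDeriv (n : ℕ) (T : ℂ[X]) :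
    (trigDeriv n T).eval 0 = -(I * n / 2) * T.eval 0 := by
  simp [trigDeriv]; ring

/-! ### Primitives, logarithms and square roots in the half-plane -/

/-- A holomorphic function in the upper half-plane has a primitive there. -/
theorem exists_primitive_upperHalf {f : ℂ → ℂ} (hf : DifferentiableOn ℂ f upperHalf) :
    ∃ g : ℂ → ℂ, ∀ z ∈ upperHalf, HasDerivAt g (f z) z := by
  -- Cayley transform from the unit disc: a primitive of `f(φ) φ'` on the disc is carried back by
  -- the inverse map `κ`.
  set φ : ℂ → ℂ := fun w => I * (1 + w) / (1 - w) with hφ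
  have hball : ∀ w ∈ Metric.ball (0 : ℂ) 1, 1 - w ≠ 0 := by
    intro w hw h
    rw [← sub_eq_zero.1 h] at hw
    simp at hw
  have hφd : ∀ w ∈ Metric.ball (0 : ℂ) 1, HasDerivAt φ (2 * I / (1 - w) ^ 2) w := by
    intro w hw
    have h1 : HasDerivAt (fun w : ℂ => I * (1 + w)) I w := by
      simpa using ((hasDerivAt_id w).const_add 1).const_mul I
    have h2 : HasDerivAt (fun w : ℂ => 1 - w) (-1) w := by
      simpa using (hasDerivAt_id w).const_sub 1
    exact (h1.div h2 (hball w hw)).congr_deriv (by ring)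
  have hφm : MapsTo φ (Metric.ball (0 : ℂ) 1) upperHalf := by
    intro w hw
    have hw' : normSq w < 1 := by
      rw [normSq_eq_norm_sq]
      have : ‖w‖ < 1 := by simpa using hw
      nlinarith [norm_nonneg w]
    have h0 : 0 < normSq (1 - w) := normSq_pos.2 (hball w hw)
    have : (φ w).im = (1 - normSq w) / normSq (1 - w) := by
      simp only [hφ, div_im, normSq_apply]
      simp
      field_simp
      ring
    change 0 < (φ w).im
    rw [this]
    exact div_pos (by linarith) h0
  have hd : DifferentiableOn ℂ (fun w => f (φ w) * (2 * I / (1 - w) ^ 2)) (Metric.ball (0 : ℂ) 1) := by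
    apply DifferentiableOn.mul
    · exact hf.comp (fun w hw => (hφd w hw).differentiableAt.differentiableWithinAt) hφm
    · apply DifferentiableOn.div (by fun_prop) (by fun_prop)
      exact fun w hw => pow_ne_zero 2 (hball w hw)
  obtain ⟨H, hH⟩ := hd.isExactOn_ball
  have hden : ∀ z ∈ upperHalf, z + I ≠ 0 := by
    intro z hz h
    have h1 : 0 < z.im := hz
    have h2 := congrArg im h
    simp at h2; linarith
  set κ : ℂ → ℂ := fun z => (z - I) / (z + I) with hκ
  refine ⟨fun z => H (κ z), fun z hz => ?_⟩
  have hz0 := hden z hz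
  have hκz : HasDerivAt κ (2 * I / (z + I) ^ 2) z := by
    have h1 : HasDerivAt (fun w : ℂ => w - I) 1 z := (hasDerivAt_id z).sub_const I
    have h2 : HasDerivAt (fun w : ℂ => w + I) 1 z := (hasDerivAt_id z).add_const I
    exact (h1.div h2 hz0).congr_deriv (by ring)
  have hκm : κ z ∈ Metric.ball (0 : ℂ) 1 := by
    have h1 : 0 < z.im := hz
    rw [mem_ball_zero_iff, norm_div, div_lt_one (norm_pos_iff.2 hz0)]
    rw [← sq_lt_sq₀ (norm_nonneg _) (norm_nonneg _), ← normSq_eq_norm_sq, ← normSq_eq_norm_sq]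
    simp [normSq_apply]
    nlinarith
  have h1z : 1 - κ z = 2 * I / (z + I) := by
    simp only [hκ]; field_simp; ring
  have hφκ : φ (κ z) = z := by
    have : 1 + κ z = 2 * z / (z + I) := by simp only [hκ]; field_simp; ring
    simp only [hφ]
    rw [h1z, this]
    field_simp
  have := (hH (κ z) hκm).comp z hκz
  refine this.congr_deriv ?_
  simp only [hφκ, h1z, mul_assoc]
  have : 2 * I / (2 * I / (z + I)) ^ 2 * (2 * I / (z + I) ^ 2) = 1 := by
    field_simp
  rw [this, mul_one]

/-- A zero-free holomorphic function in the upper half-plane is `exp (i ψ)` with `ψ` holomorphic. -/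
theorem exists_exp_I_mul_eq {u : ℂ → ℂ} (hu : DifferentiableOn ℂ u upperHalf)
    (h0 : ∀ z ∈ upperHalf, u z ≠ 0) :
    ∃ ψ : ℂ → ℂ, DifferentiableOn ℂ ψ upperHalf ∧ ∀ z ∈ upperHalf, u z = exp (I * ψ z) := by
  have hd : ∀ z ∈ upperHalf, HasDerivAt u (deriv u z) z := fun z hz =>
    (hu.differentiableAt (isOpen_upperHalf.mem_nhds hz)).hasDerivAt
  obtain ⟨g, hg⟩ := exists_primitive_upperHalf
    (f := fun z => deriv u z / u z) ((hu.deriv isOpen_upperHalf).div hu h0)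
  have hder : ∀ z ∈ upperHalf, HasDerivAt (fun z => u z * exp (-g z)) 0 z := by
    intro z hz
    refine ((hd z hz).mul ((hg z hz).neg.cexp)).congr_deriv ?_
    have := h0 z hz
    simp only [Pi.neg_apply]
    field_simp
    ring
  have hI : I ∈ upperHalf := by simp [upperHalf]
  have hconst : ∀ z ∈ upperHalf, u z * exp (-g z) = u I * exp (-g I) := fun z hz =>
    isOpen_upperHalf.is_const_of_deriv_eq_zero convex_upperHalf.isPreconnected
      (fun z hz => (hder z hz).differentiableAt.differentiableWithinAt)
      (fun z hz => (hder z hz).deriv) hz hI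
  obtain ⟨κ, hκ⟩ : ∃ κ, exp κ = u I * exp (-g I) :=
    ⟨_, exp_log (mul_ne_zero (h0 I hI) (exp_ne_zero _))⟩
  refine ⟨fun z => -I * (κ + g z), ?_, fun z hz => ?_⟩
  · exact DifferentiableOn.const_mul (DifferentiableOn.const_add _ fun z hz =>
      (hg z hz).differentiableAt.differentiableWithinAt) _
  · have : I * (-I * (κ + g z)) = κ + g z := by linear_combination (-(κ + g z)) * I_mul_I
    rw [this, exp_add, hκ, ← hconst z hz, mul_assoc, ← exp_add, neg_add_cancel, exp_zero, mul_one]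

/-- A continuous branch of the logarithm differs from the principal one by a constant where both
are defined. -/
theorem exists_eq_log_add {s : Set ℂ} (hs : IsOpen s) (hc : IsPreconnected s) (hne : s.Nonempty)
    {v : ℂ → ℂ} (hv : DifferentiableOn ℂ v s) {A : ℂ} (hA : A ≠ 0)
    (hslit : ∀ z ∈ s, exp (v z) / A ∈ slitPlane) :
    ∃ k : ℂ, exp k = A ∧ ∀ z ∈ s, v z = log (exp (v z) / A) + k := by
  set g : ℂ → ℂ := fun z => v z - log (exp (v z) / A) with hg
  have hgd : DifferentiableOn ℂ g s := hv.sub ((hv.cexp.div_const A).clog hslit)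
  have hexp : ∀ z ∈ s, exp (g z) = A := by
    intro z hz
    simp only [hg]
    rw [exp_sub, exp_log (slitPlane_ne_zero (hslit z hz))]
    field_simp [exp_ne_zero]
  -- `exp g` is constant and `exp` has no zeros, so `g' = 0`.
  have hder : s.EqOn (deriv g) 0 := by
    intro z hz
    have h1 := (hgd.differentiableAt (hs.mem_nhds hz)).hasDerivAt.cexp
    have h2 : (fun z => exp (g z)) =ᶠ[𝓝 z] fun _ => A := by
      filter_upwards [hs.mem_nhds hz] with w hw using hexp w hw
    have h3 := h1.unique ((hasDerivAt_const z A).congr_of_eventuallyEq h2)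
    exact (mul_eq_zero.1 h3).resolve_left (exp_ne_zero _)
  obtain ⟨z₀, hz₀⟩ := hne
  refine ⟨g z₀, hexp z₀ hz₀, fun z hz => ?_⟩
  have := hs.is_const_of_deriv_eq_zero hc hgd hder hz hz₀
  rw [← this]
  simp [hg]

/-- Halving an argument in `(-π, π)` puts it in `(-π/2, π/2)`: this is the source of the positive
real part of the derivative of the arccosine. -/
lemma re_exp_half_log_pos {w : ℂ} (hw : w ∈ slitPlane) : 0 < (exp (log w / 2)).re := by
  rw [exp_re]
  refine mul_pos (Real.exp_pos _) (Real.cos_pos_of_mem_Ioo ?_)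
  have h1 : (log w / 2).im = arg w / 2 := by simp [log_im]
  rw [h1]
  have h2 := neg_pi_lt_arg w
  have h3 : arg w < Real.pi := lt_of_le_of_ne (arg_le_pi w) (mem_slitPlane_iff_arg.1 hw).1
  constructor <;> linarith

lemma exp_half_log_sq {w : ℂ} (hw : w ≠ 0) : exp (log w / 2) ^ 2 = w := by
  rw [← exp_nat_mul]
  push_cast
  rw [mul_div_cancel₀ _ two_ne_zero, exp_log hw]

lemma tendsto_exp_I_mul_comap_im {c : ℝ} (hc : 0 < c) :
    Tendsto (fun z : ℂ => exp (I * (c * z))) (comap im atTop) (𝓝 0) := by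
  rw [tendsto_exp_nhds_zero_iff]
  have : (fun z : ℂ => (I * (c * z)).re) = fun z : ℂ => -(c * z.im) := by
    ext z; simp
  rw [this, tendsto_neg_atBot_iff]
  exact tendsto_comap.const_mul_atTop hc

lemma tendsto_eval_exp (T : ℂ[X]) :
    Tendsto (fun z : ℂ => T.eval (exp (I * z))) (comap im atTop) (𝓝 (T.eval 0)) := by
  have := tendsto_exp_I_mul_comap_im one_pos
  simp only [ofReal_one, one_mul] at this
  exact (T.continuous.tendsto 0).comp this

/-! ### The arccosine of a trigonometric function -/

/-- If `T` is such that `t'^2 / (1 - t^2)` avoids the negative half-axis in the upper half-plane for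
the trigonometric function `t` of `T`, then `t` has a holomorphic arccosine with values in the upper
half-plane, whose derivative has positive real part. -/
theorem exists_arccos_trig {n : ℕ} (hn : 1 ≤ n) {T : ℂ[X]} (hT0 : T.eval 0 ≠ 0)
    (hseg : ∀ z ∈ upperHalf, ∀ τ : ℝ, |τ| ≤ 1 → trig n T z ≠ τ)
    (hslit : ∀ z ∈ upperHalf, trig n (trigDeriv n T) z ^ 2 / (1 - trig n T z ^ 2) ∈ slitPlane) :
    ∃ ψ : ℂ → ℂ, DifferentiableOn ℂ ψ upperHalf ∧ (∀ z ∈ upperHalf, 0 < (deriv ψ z).re) ∧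
      (∀ z ∈ upperHalf, deriv ψ (z + 2 * Real.pi) = deriv ψ z) ∧
      (∀ z ∈ upperHalf, Complex.cos (ψ z) = trig n T z) ∧ (∀ z ∈ upperHalf, 0 < (ψ z).im) ∧
      Tendsto (fun z => exp (I * ((n : ℂ) / 2 * z - ψ z))) (comap im atTop) (𝓝 (2 * T.eval 0)) := by
  set t := trig n T with ht
  set t' := trig n (trigDeriv n T) with ht'
  have hder : ∀ z, HasDerivAt t (t' z) z := hasDerivAt_trig n T
  set G : ℂ → ℂ := fun z => t' z ^ 2 / (1 - t z ^ 2) with hG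
  have hG0 : ∀ z ∈ upperHalf, G z ≠ 0 := fun z hz => slitPlane_ne_zero (hslit z hz)
  have hden : ∀ z ∈ upperHalf, 1 - t z ^ 2 ≠ 0 := fun z hz h => hG0 z hz (by simp [hG, h])
  have hGd : DifferentiableOn ℂ G upperHalf :=
    ((differentiable_trig n _).pow 2).differentiableOn.div
      (((differentiable_trig n T).pow 2).differentiableOn.const_sub 1) hden
  -- `t = cos ψ` forces `ψ'^2 = t'^2 / (1 - t^2)`; `F` is the principal root, the intended `ψ'`, and
  -- `S = -t'/F` below is the intended `sin ψ`.
  set F : ℂ → ℂ := fun z => exp (log (G z) / 2) with hF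
  have hF0 : ∀ z, F z ≠ 0 := fun z => exp_ne_zero _
  have hFd : DifferentiableOn ℂ F upperHalf := ((hGd.clog hslit).div_const 2).cexp
  have hF2 : ∀ z ∈ upperHalf, F z ^ 2 * (1 - t z ^ 2) = t' z ^ 2 := by
    intro z hz
    rw [exp_half_log_sq (hG0 z hz)]
    exact div_mul_cancel₀ _ (hden z hz)
  set S : ℂ → ℂ := fun z => -t' z / F z with hS
  have hSd : DifferentiableOn ℂ S upperHalf :=
    (differentiable_trig n _).neg.differentiableOn.div hFd fun z _ => hF0 z
  have hSF : ∀ z, S z * F z = -t' z := fun z => div_mul_cancel₀ _ (hF0 z)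
  have hS2 : ∀ z ∈ upperHalf, S z ^ 2 = 1 - t z ^ 2 := by
    intro z hz
    have := hF2 z hz
    simp only [hS]
    rw [div_pow, div_eq_iff (pow_ne_zero 2 (hF0 z)), neg_sq, ← this]
    ring
  have hS0 : ∀ z ∈ upperHalf, S z ≠ 0 := fun z hz h => hden z hz (by rw [← hS2 z hz, h]; ring)
  have hSder : ∀ z ∈ upperHalf, HasDerivAt S (F z * t z) z := by
    intro z hz
    have h1 := (hSd.differentiableAt (isOpen_upperHalf.mem_nhds hz)).hasDerivAt
    have h2 : HasDerivAt (fun z => S z ^ 2) (-(2 * t z * t' z)) z := by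
      have h3 : HasDerivAt (fun z => 1 - t z ^ 2) (-(2 * t z * t' z)) z :=
        (((hder z).pow 2).const_sub 1).congr_deriv (by simp)
      refine h3.congr_of_eventuallyEq ?_
      filter_upwards [isOpen_upperHalf.mem_nhds hz] with w hw using hS2 w hw
    have h3 := (h1.pow 2).unique h2
    refine h1.congr_deriv (mul_left_cancel₀ (mul_ne_zero two_ne_zero (hS0 z hz)) ?_)
    simp at h3
    linear_combination h3 - 2 * t z * hSF z
  -- The intended `exp (i ψ)`: it satisfies `u' = i F u` and has inverse `t - i S`, so it has no
  -- zeros and a logarithm exists.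
  set u : ℂ → ℂ := fun z => t z + I * S z with hu
  have hud : ∀ z ∈ upperHalf, HasDerivAt u (I * F z * u z) z := by
    intro z hz
    refine ((hder z).add ((hSder z hz).const_mul I)).congr_deriv ?_
    simp only [hu]
    linear_combination -S z * F z * I_mul_I + hSF z
  have huv : ∀ z ∈ upperHalf, u z * (t z - I * S z) = 1 := by
    intro z hz
    simp only [hu]
    linear_combination hS2 z hz - S z ^ 2 * I_mul_I
  have hu0 : ∀ z ∈ upperHalf, u z ≠ 0 := fun z hz => left_ne_zero_of_mul_eq_one (huv z hz)
  obtain ⟨ψ, hψd, hψ⟩ := exists_exp_I_mul_eq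
    (fun z hz => (hud z hz).differentiableAt.differentiableWithinAt) hu0
  have hψF : ∀ z ∈ upperHalf, deriv ψ z = F z := by
    intro z hz
    have h1 := ((hψd.differentiableAt (isOpen_upperHalf.mem_nhds hz)).hasDerivAt.const_mul I).cexp
    have h2 : u =ᶠ[𝓝 z] fun z => exp (I * ψ z) := by
      filter_upwards [isOpen_upperHalf.mem_nhds hz] with w hw using hψ w hw
    have h3 := (hud z hz).unique (h1.congr_of_eventuallyEq h2)
    rw [← hψ z hz] at h3
    refine (mul_left_cancel₀ (mul_ne_zero I_ne_zero (hu0 z hz)) ?_).symm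
    linear_combination h3
  have hinv : ∀ z ∈ upperHalf, t z - I * S z = exp (-(I * ψ z)) := by
    intro z hz
    have := huv z hz
    rw [exp_neg, ← hψ z hz]
    exact eq_inv_of_mul_eq_one_right this
  have hcos : ∀ z ∈ upperHalf, Complex.cos (ψ z) = t z := by
    intro z hz
    rw [Complex.cos, mul_comm (ψ z) I, neg_mul, mul_comm (ψ z) I, ← hinv z hz, ← hψ z hz]
    simp only [hu]; ring
  have hup : ∀ᶠ z in comap im atTop, z ∈ upperHalf :=
    (eventually_gt_atTop (0 : ℝ)).comap im
  -- As `Im z → ∞`, `exp (i z) → 0`, so `G → (n/2)^2` and the principal root selects `F → n/2`. Then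
  -- `exp (i n z / 2) (t - i S)` tends to `2 T(0)`.
  have hlim : Tendsto (fun z => exp (I * ((n : ℂ) / 2 * z - ψ z))) (comap im atTop)
      (𝓝 (2 * T.eval 0)) := by
    have hnC : (n : ℂ) ≠ 0 := by exact_mod_cast (by omega : n ≠ 0)
    have hw : Tendsto (fun z : ℂ => exp (I * z) ^ n) (comap im atTop) (𝓝 0) := by
      have h1 := (tendsto_exp_I_mul_comap_im one_pos).pow n
      simpa [zero_pow (by omega : n ≠ 0)] using h1
    have hGlim : Tendsto G (comap im atTop) (𝓝 (((n / 2 : ℝ) : ℂ) ^ 2)) := by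
      have h1 := ((tendsto_eval_exp (trigDeriv n T)).pow 2).div
        (hw.sub ((tendsto_eval_exp T).pow 2)) (by simpa using hT0)
      have e1 : (trigDeriv n T).eval 0 ^ 2 / (0 - T.eval 0 ^ 2) = ((n / 2 : ℝ) : ℂ) ^ 2 := by
        rw [eval_zero_trigDeriv]
        field_simp
        push_cast
        simp only [I_sq]; ring
      rw [e1] at h1
      refine h1.congr fun z => ?_
      have e2 : exp (I * z) ^ n = exp (I * n * z / 2) ^ 2 := by
        rw [← exp_nat_mul, ← exp_nat_mul]; congr 1; push_cast; ring
      rw [Pi.div_apply, e2, ← exp_mul_trig n T, ← exp_mul_trig n (trigDeriv n T)]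
      simp only [hG]
      rw [mul_pow, mul_pow, ← mul_one_sub, mul_div_mul_left _ _ (pow_ne_zero 2 (exp_ne_zero _))]
    have hn2 : (0 : ℝ) < n / 2 := by
      have : (0 : ℝ) < n := by exact_mod_cast hn
      positivity
    have hFlim : Tendsto F (comap im atTop) (𝓝 ((n / 2 : ℝ) : ℂ)) := by
      have hsl : ((n / 2 : ℝ) : ℂ) ^ 2 ∈ slitPlane := by
        rw [← ofReal_pow]; exact ofReal_mem_slitPlane.2 (by positivity)
      have h1 := (((continuousAt_clog hsl).tendsto.comp hGlim).div_const 2).cexp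
      have e : exp (log (((n / 2 : ℝ) : ℂ) ^ 2) / 2) = ((n / 2 : ℝ) : ℂ) := by
        rw [← ofReal_pow, ← ofReal_log (by positivity), Real.log_pow]
        push_cast
        rw [mul_div_cancel_left₀ _ (two_ne_zero), ← ofReal_exp, Real.exp_log hn2]
        push_cast; rfl
      rw [e] at h1
      exact h1
    have h1 := (tendsto_eval_exp T).add
      (((tendsto_eval_exp (trigDeriv n T)).div hFlim (by exact_mod_cast hn2.ne')).const_mul I)
    have e1 : T.eval 0 + I * ((trigDeriv n T).eval 0 / ((n / 2 : ℝ) : ℂ)) = 2 * T.eval 0 := by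
      rw [eval_zero_trigDeriv]
      push_cast
      field_simp
      simp only [I_sq]; ring
    rw [e1] at h1
    refine h1.congr' ?_
    filter_upwards [hup] with z hz
    rw [show I * ((n : ℂ) / 2 * z - ψ z) = I * n * z / 2 + -(I * ψ z) by ring, exp_add,
      ← hinv z hz, Pi.div_apply, ← exp_mul_trig n T, ← exp_mul_trig n (trigDeriv n T)]
    simp only [hS, ← ht, ← ht']
    ring
  have hper2 : ∀ Q : ℂ[X], ∀ z, trig n Q (z + 2 * Real.pi) ^ 2 = trig n Q z ^ 2 := by
    intro Q z
    rw [trig_add_two_pi, mul_pow, ← pow_mul, mul_comm n 2, pow_mul]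
    norm_num
  -- A real value of `ψ` would put `t` in `[-1, 1]`. So `Im ψ` has constant sign, which is read off
  -- near `i∞`, where `exp (i ψ) → 0`.
  have him0 : ∀ z ∈ upperHalf, (ψ z).im ≠ 0 := by
    intro z hz h
    refine hseg z hz (Real.cos (ψ z).re) (Real.abs_cos_le_one _) ?_
    have : ψ z = ((ψ z).re : ℂ) := Complex.ext rfl (by simpa using h)
    rw [← hcos z hz, ofReal_cos, ← this]
  have him : ∃ z ∈ upperHalf, 0 < (ψ z).im := by
    have h1 : Tendsto (fun z : ℂ => exp (I * ψ z)) (comap im atTop) (𝓝 0) := by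
      have hn2 : (0 : ℝ) < n / 2 := by
        have : (0 : ℝ) < n := by exact_mod_cast hn
        positivity
      have h2 := (tendsto_exp_I_mul_comap_im hn2).div hlim (by simpa using hT0)
      rw [zero_div] at h2
      refine h2.congr fun z => ?_
      rw [Pi.div_apply, ← exp_sub]
      congr 1; push_cast; ring
    have h2 : ∀ᶠ z in comap im atTop, ‖exp (I * ψ z)‖ < 1 :=
      h1.norm.eventually (gt_mem_nhds (by simp))
    have : (comap im atTop).NeBot := comap_neBot_iff.2 fun s hs => by
      obtain ⟨y, hy⟩ := (Filter.nonempty_of_mem hs)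
      exact ⟨⟨0, y⟩, hy⟩
    obtain ⟨z, hz1, hz2⟩ := (h2.and hup).exists
    refine ⟨z, hz2, ?_⟩
    rw [norm_exp] at hz1
    simpa using hz1
  refine ⟨ψ, hψd, fun z hz => ?_, fun z hz => ?_, hcos, fun z hz => ?_, hlim⟩
  · rw [hψF z hz]; exact re_exp_half_log_pos (hslit z hz)
  · have hz' : z + 2 * Real.pi ∈ upperHalf := by
      have : 0 < z.im := hz
      simpa [upperHalf] using this
    rw [hψF z hz, hψF _ hz']
    simp only [hF, hG, ht, ht', hper2]
  · by_contra hcon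
    obtain ⟨z₁, hz₁, h1⟩ := him
    obtain ⟨w, hw, hw0⟩ := convex_upperHalf.isPreconnected.intermediate_value hz hz₁
      (continuous_im.comp_continuousOn hψd.continuousOn) ⟨not_lt.1 hcon, h1.le⟩
    exact him0 w hw hw0

/-! ### Boundary values at the ends of the gap and behaviour at infinity -/

/-- A function with real values on the real line and derivative of positive real part at a real
point maps the upper half-plane near that point into the upper half-plane. -/
theorem eventually_im_pos {f : ℂ → ℂ} (hf : Differentiable ℂ f) (hr : ∀ x : ℝ, (f x).im = 0) {a : ℝ}
    (ha : 0 < (deriv f a).re) : ∀ᶠ z in 𝓝[upperHalf] (a : ℂ), 0 < (f z).im := by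
  have hc : Continuous (deriv f) := (hf.contDiff (n := 1)).continuous_deriv le_rfl
  have h1 : ∀ᶠ z in 𝓝 (a : ℂ), 0 < (deriv f z).re :=
    (continuous_re.comp hc).continuousAt.eventually (lt_mem_nhds ha)
  obtain ⟨r, hr0, hrb⟩ := Metric.eventually_nhds_iff_ball.1 h1
  rw [eventually_nhdsWithin_iff]
  filter_upwards [Metric.ball_mem_nhds (a : ℂ) hr0] with z hz hzu
  have hzu : 0 < z.im := hzu
  -- Compare `z` with its projection `Re z`, which stays in the ball and where `f` is real.
  have hx : (z.re : ℂ) ∈ Metric.ball (a : ℂ) r := by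
    rw [mem_ball_iff_norm] at hz ⊢
    refine lt_of_le_of_lt ?_ hz
    rw [← ofReal_sub, norm_real]
    simpa using abs_re_le_norm (z - a)
  have hne : (z.re : ℂ) ≠ z := fun h => hzu.ne (by simpa using congrArg im h)
  have := re_mul_conj_pos Metric.isOpen_ball (convex_ball _ _) hf.differentiableOn hrb hx hz hne
  have h0 := hr z.re
  simp [h0] at this
  exact pos_of_mul_pos_left this hzu.le

lemma neBot_comap_im : (comap im atTop).NeBot := comap_neBot_iff.2 fun s hs => by
  obtain ⟨y, hy⟩ := (Filter.nonempty_of_mem hs)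
  exact ⟨⟨0, y⟩, hy⟩

/-- A branch `ψ` of the arccosine normalized like `n z / 2` at infinity stays within bounded
distance of it, and is quasi-periodic. -/
theorem bounded_and_periodic_of_tendsto {α : ℝ} {ψ : ℂ → ℂ} (hψ : DifferentiableOn ℂ ψ upperHalf)
    (hper : ∀ z ∈ upperHalf, deriv ψ (z + 2 * Real.pi) = deriv ψ z) {A : ℂ} (hA : A ≠ 0)
    (hlim : Tendsto (fun z => exp (I * (α * z - ψ z))) (comap im atTop) (𝓝 A)) :
    (∃ C Y : ℝ, ∀ z : ℂ, Y < z.im → ‖ψ z - α * z‖ ≤ C) ∧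
      ∀ z ∈ upperHalf, ψ (z + 2 * Real.pi) = ψ z + α * (2 * Real.pi) := by
  set v : ℂ → ℂ := fun z => I * (α * z - ψ z) with hv
  have hlim1 : Tendsto (fun z => exp (v z) / A) (comap im atTop) (𝓝 1) := by
    have := hlim.div_const A
    rwa [div_self hA] at this
  have hlog : Tendsto (fun z => log (exp (v z) / A)) (comap im atTop) (𝓝 0) := by
    have := (continuousAt_clog one_mem_slitPlane).tendsto.comp hlim1
    rwa [log_one] at this
  obtain ⟨Y, hY⟩ : ∃ Y : ℝ, 0 < Y ∧ ∀ z : ℂ, Y < z.im →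
      exp (v z) / A ∈ slitPlane ∧ ‖log (exp (v z) / A)‖ < 1 := by
    have h1 : ∀ᶠ z in comap im atTop, exp (v z) / A ∈ slitPlane ∧ ‖log (exp (v z) / A)‖ < 1 :=
      (hlim1.eventually (isOpen_slitPlane.mem_nhds one_mem_slitPlane)).and
        (hlog.norm.eventually (gt_mem_nhds (by simp)))
    rw [eventually_comap] at h1
    obtain ⟨Y, hY⟩ := eventually_atTop.1 h1
    exact ⟨max Y 1, by positivity, fun z hz => hY z.im ((le_max_left _ _).trans hz.le) z rfl⟩
  set s : Set ℂ := {z | Y < z.im} with hs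
  have hsu : s ⊆ upperHalf := fun z hz => hY.1.trans hz
  have hvd : DifferentiableOn ℂ v s :=
    ((differentiableOn_id.const_mul (α : ℂ)).sub (hψ.mono hsu)).const_mul I
  have hne : s.Nonempty := ⟨⟨0, Y + 1⟩, by simp [hs]⟩
  obtain ⟨k, -, hk⟩ := exists_eq_log_add (isOpen_lt continuous_const Complex.continuous_im)
    (convex_halfSpace_im_gt Y).isPreconnected hne hvd hA fun z hz => (hY.2 z hz).1
  constructor
  · refine ⟨1 + ‖k‖, Y, fun z hz => ?_⟩
    have h1 : ‖ψ z - α * z‖ = ‖v z‖ := by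
      simp only [hv]
      rw [norm_mul, norm_I, one_mul, norm_sub_rev]
    rw [h1, hk z hz]
    exact (norm_add_le _ _).trans (by gcongr; exact (hY.2 z hz).2.le)
  · have hshift : ∀ z ∈ upperHalf, z + 2 * Real.pi ∈ upperHalf := by
      intro z hz
      have : 0 < z.im := hz
      simpa [upperHalf] using this
    have hd : ∀ z ∈ upperHalf, HasDerivAt (fun z => ψ (z + 2 * Real.pi) - ψ z) 0 z := by
      intro z hz
      have h1 := (hψ.differentiableAt (isOpen_upperHalf.mem_nhds (hshift z hz))).hasDerivAt
      have h2 := (hψ.differentiableAt (isOpen_upperHalf.mem_nhds hz)).hasDerivAt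
      refine ((h1.comp_add_const z (2 * Real.pi : ℂ)).sub h2).congr_deriv ?_
      rw [hper z hz, sub_self]
    -- The increment over a period is constant; it is identified at `i∞`, where `v(z + 2π) - v(z) →
    -- 0`.
    have hconst : ∀ z ∈ upperHalf, ψ (z + 2 * Real.pi) - ψ z = ψ (I + 2 * Real.pi) - ψ I := fun z hz =>
      isOpen_upperHalf.is_const_of_deriv_eq_zero convex_upperHalf.isPreconnected
        (fun z hz => (hd z hz).differentiableAt.differentiableWithinAt)
        (fun z hz => (hd z hz).deriv) hz (by simp [upperHalf])
    have htr : Tendsto (fun z : ℂ => z + 2 * Real.pi) (comap im atTop) (comap im atTop) := by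
      rw [tendsto_comap_iff]
      refine tendsto_comap.congr fun z => ?_
      simp
    have hlim0 : Tendsto (fun z => v (z + 2 * Real.pi) - v z) (comap im atTop) (𝓝 0) := by
      have h1 := (hlog.comp htr).sub hlog
      rw [sub_zero] at h1
      refine h1.congr' ?_
      have hsl : ∀ᶠ z in comap im atTop, z ∈ s := (eventually_gt_atTop Y).comap im
      filter_upwards [hsl, htr.eventually hsl] with z h2 h3
      rw [Function.comp_apply]
      linear_combination hk z h2 - hk _ h3
    have hcst : Tendsto (fun z => v (z + 2 * Real.pi) - v z) (comap im atTop)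
        (𝓝 (I * (α * (2 * Real.pi) - (ψ (I + 2 * Real.pi) - ψ I)))) := by
      refine tendsto_const_nhds.congr' ?_
      have hup : ∀ᶠ z in comap im atTop, z ∈ upperHalf := (eventually_gt_atTop (0 : ℝ)).comap im
      filter_upwards [hup] with z hz
      rw [← hconst z hz]
      simp only [hv]; ring
    have := neBot_comap_im
    have h0 := (mul_eq_zero.1 (tendsto_nhds_unique hcst hlim0)).resolve_left I_ne_zero
    intro z hz
    linear_combination hconst z hz - h0

/-- From `(exp (iψ) - 1)^2 = 2 exp (iψ) (cos ψ - 1)` and `|exp (iψ)| ≤ 1`, the limit `t → 1` gives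
`exp (iψ) → 1`; the principal logarithm then recovers `ψ → 0`. -/
theorem tendsto_zero_of_log {t ψ : ℂ → ℂ} (ht : Continuous t) {x : ℝ} (hx : t x = 1)
    (hcos : ∀ z ∈ upperHalf, Complex.cos (ψ z) = t z) (him : ∀ z ∈ upperHalf, 0 < (ψ z).im)
    (hlog : ∀ᶠ z in 𝓝[upperHalf] (x : ℂ), I * ψ z = log (exp (I * ψ z))) :
    Tendsto ψ (𝓝[upperHalf] (x : ℂ)) (𝓝 0) := by
  have hup : ∀ᶠ z in 𝓝[upperHalf] (x : ℂ), z ∈ upperHalf := self_mem_nhdsWithin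
  have h1 : Tendsto (fun z => exp (I * ψ z)) (𝓝[upperHalf] (x : ℂ)) (𝓝 1) := by
    have h2 : Tendsto (fun z => 2 * ‖t z - 1‖) (𝓝[upperHalf] (x : ℂ)) (𝓝 0) := by
      have := (((ht.tendsto (x : ℂ)).sub_const 1).norm.const_mul 2).mono_left
        (nhdsWithin_le_nhds (s := upperHalf))
      simpa [hx] using this
    have h3 : Tendsto (fun z => ‖exp (I * ψ z) - 1‖ ^ 2) (𝓝[upperHalf] (x : ℂ)) (𝓝 0) := by
      refine squeeze_zero' (Eventually.of_forall fun z => by positivity) ?_ h2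
      filter_upwards [hup] with z hz
      have e : (exp (I * ψ z) - 1) ^ 2 = 2 * exp (I * ψ z) * (t z - 1) := by
        rw [← hcos z hz, Complex.cos, mul_comm (ψ z) I, neg_mul, mul_comm (ψ z) I]
        have : exp (I * ψ z) * exp (-(I * ψ z)) = 1 := by rw [← exp_add, add_neg_cancel, exp_zero]
        linear_combination -this
      rw [← norm_pow, e, norm_mul, norm_mul]
      have h4 : ‖exp (I * ψ z)‖ ≤ 1 := by
        rw [norm_exp]
        have := him z hz
        simp [this.le]
      have h5 : ‖(2 : ℂ)‖ = 2 := by simp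
      rw [h5]
      nlinarith [norm_nonneg (t z - 1)]
    rw [tendsto_iff_norm_sub_tendsto_zero]
    have := h3.sqrt
    simpa using this
  have h2 : Tendsto (fun z => -I * log (exp (I * ψ z))) (𝓝[upperHalf] (x : ℂ)) (𝓝 0) := by
    have := ((continuousAt_clog one_mem_slitPlane).tendsto.comp h1).const_mul (-I)
    simpa using this
  refine h2.congr' ?_
  filter_upwards [hlog] with z hz
  rw [← hz, ← mul_assoc]; simp

/-- The comb function of a trigonometric polynomial whose associated function
`t'^2 / (1 - t^2)` avoids the negative half-axis. -/
theorem exists_isCombMap {n : ℕ} (hn : 1 ≤ n) {T : ℂ[X]} (hT0 : T.eval 0 ≠ 0)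
    (hreal : ∀ x : ℝ, (trig n T x).im = 0)
    (hseg : ∀ z ∈ upperHalf, ∀ τ : ℝ, |τ| ≤ 1 → trig n T z ≠ τ)
    (hslit : ∀ z ∈ upperHalf, trig n (trigDeriv n T) z ^ 2 / (1 - trig n T z ^ 2) ∈ slitPlane)
    {a b : ℝ} (hab : a < b) (ha : trig n T a = 1) (hb : trig n T b = 1)
    (hgap : ∀ x ∈ Ioo a b, 1 < (trig n T x).re)
    (ha' : 0 < (trig n (trigDeriv n T) a).re) (hb' : (trig n (trigDeriv n T) b).re < 0) :
    ∃ θ : ℂ → ℂ, IsCombMap n a b θ ∧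
      ∀ z ∈ upperHalf, trig n T z = Complex.cos ((n : ℂ) / 2 * θ z) := by
  obtain ⟨ψ, hψd, hre, hper, hcos, him, hlim⟩ := exists_arccos_trig hn hT0 hseg hslit
  have hcont := continuous_trig n T
  have hn0 : (0 : ℝ) < n := by exact_mod_cast hn
  have hnC : (n : ℂ) ≠ 0 := by exact_mod_cast hn0.ne'
  obtain ⟨⟨C, Y, hCY⟩, hqper⟩ := bounded_and_periodic_of_tendsto (α := n / 2) hψd hper
    (mul_ne_zero two_ne_zero hT0) (by simpa using hlim)
  -- a convex neighbourhood of the gap on which `Re t > 0`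
  obtain ⟨δ, hδ, hsub⟩ := (isCompact_Icc.image continuous_ofReal).exists_thickening_subset_open
    (s := ofReal '' Icc a b) (isOpen_lt continuous_const (continuous_re.comp hcont) :
      IsOpen {z : ℂ | 0 < (trig n T z).re}) (by
    rintro _ ⟨x, hx, rfl⟩
    rw [mem_ofPred_eq]
    rcases hx.1.eq_or_lt with rfl | h1
    · simp [ha]
    · rcases hx.2.eq_or_lt with rfl | h2
      · simp [hb]
      · exact one_pos.trans (hgap x ⟨h1, h2⟩))
  set N := Metric.thickening δ (ofReal '' Icc a b) with hN
  have hNo : IsOpen N := Metric.isOpen_thickening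
  have hNc : Convex ℝ N := ((convex_Icc a b).linear_image ofRealCLM.toLinearMap).thickening δ
  have hNmem : ∀ x ∈ Icc a b, N ∈ 𝓝 (x : ℂ) := fun x hx =>
    hNo.mem_nhds (Metric.self_subset_thickening hδ _ ⟨x, hx, rfl⟩)
  set s := N ∩ upperHalf with hs
  have hso : IsOpen s := hNo.inter isOpen_upperHalf
  have hsne : s.Nonempty := by
    have := upperHalf_nhdsWithin_neBot a
    have h1 : s ∈ 𝓝[upperHalf] (a : ℂ) :=
      inter_mem (mem_nhdsWithin_of_mem_nhds (hNmem a (left_mem_Icc.2 hab.le))) self_mem_nhdsWithin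
    exact nonempty_of_mem h1
  -- With `w = exp (iψ)`, `Re cos ψ = Re w (1 + 1/|w|^2) / 2`, so positivity of `Re t` passes to `Re
  -- w`.
  have hpos : ∀ z ∈ s, 0 < (exp (I * ψ z)).re := by
    intro z hz
    have h1 : 0 < (trig n T z).re := hsub hz.1
    rw [← hcos z hz.2, Complex.cos, mul_comm (ψ z) I, neg_mul, mul_comm (ψ z) I, exp_neg] at h1
    have h2 : 0 < normSq (exp (I * ψ z)) := normSq_pos.2 (exp_ne_zero _)
    set w := exp (I * ψ z)
    have h3 : ((w + w⁻¹) / 2).re = w.re * ((1 + 1 / normSq w) / 2) := by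
      rw [show (w + w⁻¹) / 2 = ((1 / 2 : ℝ) : ℂ) * (w + w⁻¹) by push_cast; ring, re_ofReal_mul, add_re, inv_re]
      ring
    rw [h3] at h1
    exact pos_of_mul_pos_left h1 (by positivity)
  obtain ⟨k, hk1, hk⟩ := exists_eq_log_add hso (hNc.inter convex_upperHalf).isPreconnected hsne
    (v := fun z => I * ψ z) ((hψd.mono inter_subset_right).const_mul I) one_ne_zero
    (fun z hz => by rw [div_one]; exact Or.inl (hpos z hz))
  obtain ⟨q, rfl⟩ := exp_eq_one_iff.1 hk1
  simp only [div_one] at hk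
  -- The multiple of `2π` is removed once for the whole neighbourhood of the gap, so the same branch
  -- vanishes at both `a` and `b`.
  set χ : ℂ → ℂ := fun z => ψ z - q * (2 * Real.pi) with hχ
  have hχexp : ∀ z, exp (I * χ z) = exp (I * ψ z) := by
    intro z
    rw [show I * χ z = I * ψ z - q * (2 * Real.pi * I) by simp only [hχ]; ring, exp_sub,
      exp_int_mul_two_pi_mul_I, div_one]
  have hχlog : ∀ z ∈ s, I * χ z = log (exp (I * χ z)) := by
    intro z hz
    rw [hχexp]
    have := hk z hz
    simp only [hχ]
    linear_combination this
  have hχcos : ∀ z ∈ upperHalf, Complex.cos (χ z) = trig n T z := by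
    intro z hz
    rw [← hcos z hz]
    exact Complex.cos_sub_int_mul_two_pi _ _
  have hχim : ∀ z ∈ upperHalf, 0 < (χ z).im := by
    intro z hz
    have e : (q * (2 * (Real.pi : ℂ))).im = 0 := by
      rw [show (q * (2 * (Real.pi : ℂ))) = ((q * (2 * Real.pi) : ℝ) : ℂ) by push_cast; rfl, ofReal_im]
    simp only [hχ, sub_im, e, sub_zero]
    exact him z hz
  have hχarg : ∀ z ∈ s, |(χ z).re| < Real.pi / 2 := by
    intro z hz
    have h1 := congrArg im (hχlog z hz)
    rw [log_im] at h1
    simp at h1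
    rw [h1, abs_arg_lt_pi_div_two_iff]
    left
    rw [hχexp]; exact hpos z hz
  have hsev : ∀ x ∈ Icc a b, ∀ᶠ z in 𝓝[upperHalf] (x : ℂ), z ∈ s := fun x hx =>
    inter_mem (mem_nhdsWithin_of_mem_nhds (hNmem x hx)) self_mem_nhdsWithin
  have hχim' : ∀ z, (trig n T z) = Complex.cos (χ z) →
      (trig n T z).im = -(Real.sin (χ z).re * Real.sinh (χ z).im) := by
    intro z hz
    rw [hz]
    conv_lhs => rw [← re_add_im (χ z)]
    rw [Complex.cos_add_mul_I, ← ofReal_cos, ← ofReal_sin, ← ofReal_cosh,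
      ← ofReal_sinh, ← ofReal_mul, ← ofReal_mul, sub_im, ofReal_im, im_ofReal_mul, I_im, mul_one,
      zero_sub]
  have ha0 := tendsto_zero_of_log hcont ha hχcos hχim
    ((hsev a (left_mem_Icc.2 hab.le)).mono hχlog)
  have hb0 := tendsto_zero_of_log hcont hb hχcos hχim
    ((hsev b (right_mem_Icc.2 hab.le)).mono hχlog)
  have hda : deriv (trig n T) a = trig n (trigDeriv n T) a := (hasDerivAt_trig n T a).deriv
  have hdb : deriv (-trig n T) b = -trig n (trigDeriv n T) b := (hasDerivAt_trig n T b).neg.deriv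
  -- As `t'(a) > 0`, `Im t > 0` near `a`; since `Im t = -sin (Re χ) sinh (Im χ)` and `|Re χ| < π/2`,
  -- `Re χ` is negative. At `b` the sign of `t'` is reversed.
  have haneg : ∀ᶠ z in 𝓝[upperHalf] (a : ℂ), (χ z).re < 0 := by
    filter_upwards [eventually_im_pos (differentiable_trig n T) hreal (by rw [hda]; exact ha'),
      hsev a (left_mem_Icc.2 hab.le)] with z h1 h2
    rw [hχim' z (hχcos z h2.2).symm] at h1
    by_contra hcon
    have h3 := abs_lt.1 (hχarg z h2)
    have h4 := Real.sin_nonneg_of_nonneg_of_le_pi (not_lt.1 hcon) (by linarith)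
    have h5 := Real.sinh_pos_iff.2 (hχim z h2.2)
    nlinarith [mul_nonneg h4 h5.le]
  have hbpos : ∀ᶠ z in 𝓝[upperHalf] (b : ℂ), 0 < (χ z).re := by
    filter_upwards [eventually_im_pos (differentiable_trig n T).neg (fun x => by simp [hreal x])
      (by rw [hdb, neg_re]; linarith), hsev b (right_mem_Icc.2 hab.le)] with z h1 h2
    rw [Pi.neg_apply, neg_im, hχim' z (hχcos z h2.2).symm] at h1
    by_contra hcon
    have h3 := abs_lt.1 (hχarg z h2)
    have h4 := Real.sin_nonpos_of_nonpos_of_neg_pi_le (not_lt.1 hcon) (by linarith)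
    have h5 := Real.sinh_pos_iff.2 (hχim z h2.2)
    nlinarith [mul_nonneg (neg_nonneg.2 h4) h5.le]
  set r : ℝ := 2 / n with hr
  have hr0 : 0 < r := by positivity
  set θ : ℂ → ℂ := fun z => (r : ℂ) * χ z with hθ
  have hθχ : ∀ z, (n : ℂ) / 2 * θ z = χ z := by
    intro z
    simp only [hθ, hr]; push_cast; field_simp
  have hrn : (r : ℂ) * ((n / 2 : ℝ) : ℂ) = 1 := by
    rw [← ofReal_mul, hr]
    field_simp; simp
  have hχd : DifferentiableOn ℂ χ upperHalf := hψd.sub_const _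
  refine ⟨θ, isCombMap_of_cos hn hcont hreal hgap (fun z hz => by rw [hθχ, hχcos z hz])
    (hχd.const_mul _) ?_ ?_ ?_ ?_ ?_ ?_, fun z hz => by rw [hθχ, hχcos z hz]⟩
  · intro z hz
    have h1 : deriv θ z = r * deriv ψ z := by
      have := (hψd.differentiableAt (isOpen_upperHalf.mem_nhds hz)).hasDerivAt
      exact ((this.sub_const _).const_mul _).deriv
    rw [h1, re_ofReal_mul]
    exact mul_pos hr0 (hre z hz)
  · intro z hz
    simp only [hθ, hχ]
    rw [hqper z hz]
    linear_combination (2 * (Real.pi : ℂ)) * hrn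
  · intro z hz
    simp only [hθ, im_ofReal_mul]
    exact mul_pos hr0 (hχim z hz)
  · refine ⟨r * (C + ‖(q * (2 * Real.pi) : ℂ)‖), Y, fun z hz => ?_⟩
    have e : θ z - z = r * ((ψ z - ((n / 2 : ℝ) : ℂ) * z) - q * (2 * Real.pi)) := by
      simp only [hθ, hχ]
      linear_combination z * hrn
    rw [e, norm_mul, norm_real, Real.norm_of_nonneg hr0.le]
    gcongr
    exact (norm_sub_le _ _).trans (by gcongr; exact hCY z hz)
  · refine tendsto_nhdsWithin_iff.2 ⟨by simpa using ha0.const_mul (r : ℂ), ?_⟩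
    filter_upwards [haneg] with z hz
    simp only [hθ, re_ofReal_mul]
    nlinarith
  · refine tendsto_nhdsWithin_iff.2 ⟨by simpa using hb0.const_mul (r : ℂ), ?_⟩
    filter_upwards [hbpos] with z hz
    simp only [hθ, re_ofReal_mul]
    nlinarith

/-! ### Counting zeros on the circle -/

lemma norm_circlePt (x : ℝ) : ‖circlePt x‖ = 1 := by
  rw [circlePt, mul_comm, norm_exp_ofReal_mul_I]

lemma circlePt_ne_zero (x : ℝ) : circlePt x ≠ 0 := exp_ne_zero _

lemma circlePt_add_int_mul (x : ℝ) (q : ℤ) : circlePt (x + q * (2 * Real.pi)) = circlePt x := by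
  rw [circlePt, circlePt, exp_eq_exp_iff_exists_int]
  exact ⟨q, by push_cast; ring⟩

lemma circlePt_eq_iff {x y : ℝ} : circlePt x = circlePt y ↔ ∃ q : ℤ, x = y + q * (2 * Real.pi) := by
  constructor
  · intro h
    obtain ⟨q, hq⟩ := exp_eq_exp_iff_exists_int.1 h
    refine ⟨q, ?_⟩
    have h1 : I * (x : ℂ) = I * ((y + q * (2 * Real.pi) : ℝ) : ℂ) := by
      rw [hq]; push_cast; ring
    exact_mod_cast mul_left_cancel₀ I_ne_zero h1
  · rintro ⟨q, rfl⟩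
    exact circlePt_add_int_mul y q

lemma circlePt_inj {x y : ℝ} (h : circlePt x = circlePt y) (hxy : |x - y| < 2 * Real.pi) : x = y := by
  obtain ⟨q, hq⟩ := circlePt_eq_iff.1 h
  have hpi := Real.pi_pos
  have hq0 : q = 0 := by
    by_contra hne
    have h1 : (1 : ℝ) ≤ |(q : ℝ)| := by exact_mod_cast Int.one_le_abs hne
    rw [show x - y = q * (2 * Real.pi) by linarith, abs_mul, abs_of_pos (by positivity : 0 < 2 * Real.pi)] at hxy
    nlinarith
  rw [hq, hq0]; simp

lemma continuous_circlePt : Continuous circlePt := by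
  unfold circlePt; fun_prop

lemma trig_eq_zero_iff {n : ℕ} {T : ℂ[X]} {z : ℂ} : trig n T z = 0 ↔ T.eval (exp (I * z)) = 0 := by
  simp [trig, exp_ne_zero]

lemma trig_ofReal_eq_zero_iff {n : ℕ} {T : ℂ[X]} {x : ℝ} :
    trig n T x = 0 ↔ T.eval (circlePt x) = 0 := trig_eq_zero_iff

/-- Points `c k` in consecutive arcs `(l k, r k)`, `k < n`, of a window of length `2π`. -/
structure IsArcSystem (n : ℕ) (L : ℝ) (l r c : ℕ → ℝ) : Prop where
  mem : ∀ k < n, l k < c k ∧ c k < r k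
  window : ∀ k < n, L ≤ l k ∧ r k ≤ L + 2 * Real.pi
  disjoint : ∀ k k', k < k' → k' < n → r k ≤ l k'

namespace IsArcSystem

variable {n : ℕ} {L : ℝ} {l r c : ℕ → ℝ} (h : IsArcSystem n L l r c)

include h

lemma circlePt_ne {k k' : ℕ} (hk : k < n) (hk' : k' < n) (hne : k ≠ k') {x y : ℝ}
    (hx : x ∈ Ioo (l k) (r k)) (hy : y ∈ Ioo (l k') (r k')) : circlePt x ≠ circlePt y := by
  intro heq
  have h1 := h.window k hk
  have h2 := h.window k' hk'
  have hxy : x = y := circlePt_inj heq (by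
    rw [abs_lt]; constructor <;> linarith [hx.1, hx.2, hy.1, hy.2])
  rcases lt_or_gt_of_ne hne with h3 | h3
  · have := h.disjoint k k' h3 hk'
    linarith [hx.2, hy.1]
  · have := h.disjoint k' k h3 hk
    linarith [hx.1, hy.2]

/-- A polynomial of degree at most `2n` with two zeros on each arc has no zeros off the circle. -/
theorem norm_eq_one_of_eval_eq_zero (hn : 1 ≤ n) {R : ℂ[X]} (hR : R.natDegree ≤ 2 * n) {f : ℝ → ℝ}
    (hf : Continuous f) (hRf : ∀ x : ℝ, R.eval (circlePt x) = circlePt x ^ n * f x)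
    (hl : ∀ k < n, f (l k) < 0) (hr : ∀ k < n, f (r k) < 0) (hc : ∀ k < n, 0 ≤ f (c k))
    (hd : ∀ k < n, f (c k) = 0 → R.derivative.eval (circlePt (c k)) = 0)
    {w : ℂ} (hw : R.eval w = 0) : ‖w‖ = 1 := by
  have hR0 : R ≠ 0 := by
    rintro rfl
    have h1 := hRf (l 0)
    rw [eval_zero] at h1
    rcases mul_eq_zero.1 h1.symm with h2 | h2
    · exact pow_ne_zero n (circlePt_ne_zero _) h2
    · exact (hl 0 hn).ne (by exact_mod_cast h2)
  have hroot : ∀ x, f x = 0 → R.eval (circlePt x) = 0 := fun x hx => by rw [hRf, hx]; simp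
  -- If `f (c k) = 0`, the zero there is double; otherwise `f` changes sign on each side of `c k`.
  have hpair : ∀ k < n, ∃ x ∈ Ioo (l k) (r k), ∃ y ∈ Ioo (l k) (r k),
      (X - C (circlePt x)) * (X - C (circlePt y)) ∣ R := by
    intro k hk
    have hm := h.mem k hk
    rcases (hc k hk).eq_or_lt with h0 | h0
    · refine ⟨c k, hm, c k, hm, ?_⟩
      rw [← sq, ← le_rootMultiplicity_iff hR0]
      exact (one_lt_rootMultiplicity_iff_isRoot hR0).2 ⟨hroot _ h0.symm, hd k hk h0.symm⟩
    · obtain ⟨x, hx, hx0⟩ := intermediate_value_Ioo hm.1.le hf.continuousOn ⟨hl k hk, h0⟩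
      obtain ⟨y, hy, hy0⟩ := intermediate_value_Ioo' hm.2.le hf.continuousOn ⟨hr k hk, h0⟩
      refine ⟨x, ⟨hx.1, hx.2.trans hm.2⟩, y, ⟨hm.1.trans hy.1, hy.2⟩, ?_⟩
      refine IsCoprime.mul_dvd (isCoprime_X_sub_C_of_isUnit_sub ?_)
        (dvd_iff_isRoot.2 (hroot _ hx0)) (dvd_iff_isRoot.2 (hroot _ hy0))
      refine isUnit_iff_ne_zero.2 (sub_ne_zero.2 fun heq => ?_)
      have h1 := h.window k hk
      have := circlePt_inj heq (by rw [abs_lt]; constructor <;> linarith [hx.1, hx.2, hy.1, hy.2])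
      linarith [hx.2, hy.1]
  choose! x hx y hy hdvd using hpair
  by_contra hnorm
  have hcop : ∀ a b : ℂ, a ≠ b → IsCoprime (X - C a) (X - C b) := fun a b hab =>
    isCoprime_X_sub_C_of_isUnit_sub (isUnit_iff_ne_zero.2 (sub_ne_zero.2 hab))
  have hprod : (∏ k ∈ Finset.range n, (X - C (circlePt (x k))) * (X - C (circlePt (y k)))) ∣ R := by
    refine Finset.prod_dvd_of_coprime ?_ fun k hk => hdvd k (Finset.mem_range.1 hk)
    intro k hk k' hk' hne
    have hk := Finset.mem_range.1 (Finset.mem_coe.1 hk)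
    have hk' := Finset.mem_range.1 (Finset.mem_coe.1 hk')
    exact ((hcop _ _ (h.circlePt_ne hk hk' hne (hx k hk) (hx k' hk'))).mul_right
      (hcop _ _ (h.circlePt_ne hk hk' hne (hx k hk) (hy k' hk')))).mul_left
      ((hcop _ _ (h.circlePt_ne hk hk' hne (hy k hk) (hx k' hk'))).mul_right
      (hcop _ _ (h.circlePt_ne hk hk' hne (hy k hk) (hy k' hk'))))
  -- The `2n` zeros on the arcs and one off the circle exceed the degree.
  have hall := IsCoprime.mul_dvd (IsCoprime.prod_left fun k _ => IsCoprime.mul_left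
    (hcop (circlePt (x k)) w fun heq => hnorm (heq ▸ norm_circlePt _))
    (hcop (circlePt (y k)) w fun heq => hnorm (heq ▸ norm_circlePt _))) hprod
    (dvd_iff_isRoot.2 hw)
  have hdeg := natDegree_le_of_dvd hall hR0
  have hmon : (∏ k ∈ Finset.range n, (X - C (circlePt (x k))) * (X - C (circlePt (y k)))).Monic :=
    monic_prod_of_monic _ _ fun k _ => (monic_X_sub_C _).mul (monic_X_sub_C _)
  rw [hmon.natDegree_mul (monic_X_sub_C w), natDegree_prod_of_monic _ _
    fun k _ => (monic_X_sub_C _).mul (monic_X_sub_C _)] at hdeg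
  have : ∀ k ∈ Finset.range n, ((X - C (circlePt (x k))) * (X - C (circlePt (y k)))).natDegree = 2 :=
    fun k _ => by
      rw [(monic_X_sub_C _).natDegree_mul (monic_X_sub_C _), natDegree_X_sub_C, natDegree_X_sub_C]
  rw [Finset.sum_congr rfl this, natDegree_X_sub_C] at hdeg
  simp at hdeg
  omega

end IsArcSystem

/-- A nonzero polynomial of degree at most `n` with `n` zeros on the circle has no others. -/
theorem exists_eq_circlePt_of_eval_eq_zero {n : ℕ} {Q : ℂ[X]} (hQ : Q.natDegree ≤ n) (hQ0 : Q ≠ 0)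
    {x : ℕ → ℝ} (hx : ∀ k < n, Q.eval (circlePt (x k)) = 0)
    (hinj : ∀ k < n, ∀ k' < n, k ≠ k' → circlePt (x k) ≠ circlePt (x k'))
    {w : ℂ} (hw : Q.eval w = 0) : ∃ k < n, w = circlePt (x k) := by
  by_contra! hcon
  set S : Finset ℂ := insert w ((Finset.range n).image fun k => circlePt (x k)) with hS
  have hcard : S.card = n + 1 := by
    rw [hS, Finset.card_insert_of_notMem, Finset.card_image_of_injOn, Finset.card_range]
    · intro k hk k' hk' heq
      by_contra hne
      exact hinj k (by simpa using hk) k' (by simpa using hk') hne heq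
    · intro hmem
      obtain ⟨k, hk, hkw⟩ := Finset.mem_image.1 hmem
      exact hcon k (Finset.mem_range.1 hk) hkw.symm
  refine hQ0 (eq_zero_of_natDegree_lt_card_of_eval_eq_zero' Q S ?_ (by omega))
  intro v hv
  rcases Finset.mem_insert.1 hv with rfl | hv
  · exact hw
  · obtain ⟨k, hk, rfl⟩ := Finset.mem_image.1 hv
    exact hx k (Finset.mem_range.1 hk)

section Real

variable {n : ℕ} {T : ℂ[X]} (hreal : ∀ x : ℝ, (trig n T x).im = 0)

lemma hasDerivAt_trig_re (n : ℕ) (T : ℂ[X]) (x : ℝ) :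
    HasDerivAt (fun x : ℝ => (trig n T x).re) (trig n (trigDeriv n T) x).re x :=
  (hasDerivAt_trig n T x).real_of_complex

include hreal

lemma ofReal_trig_re (x : ℝ) : (((trig n T x).re : ℝ) : ℂ) = trig n T x :=
  Complex.ext rfl (by simp [hreal x])

lemma trigDeriv_real (x : ℝ) : (trig n (trigDeriv n T) x).im = 0 := by
  have h1 := (hasDerivAt_trig n T x).comp_ofReal
  have h3 := imCLM.hasFDerivAt.comp_hasDerivAt x h1
  have h4 : (imCLM ∘ fun y : ℝ => trig n T y) = fun _ => 0 := by
    ext y; exact hreal y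
  rw [h4] at h3
  exact h3.unique (hasDerivAt_const x (0 : ℝ))

end Real

/-- If the zeros `l k`, `r k` of a real trigonometric function `t` are separated by critical points
`c k` with `|t (c k)| ≥ 1`, then `t^2 - μ t'^2 = τ^2` has no solutions in the upper half-plane. -/
theorem trig_sq_sub_ne {n : ℕ} (hn : 1 ≤ n) {T : ℂ[X]} (hT : T.natDegree ≤ n)
    (hreal : ∀ x : ℝ, (trig n T x).im = 0) {L : ℝ} {l r c : ℕ → ℝ} (h : IsArcSystem n L l r c)
    (hl : ∀ k < n, trig n T (l k) = 0) (hr : ∀ k < n, trig n T (r k) = 0)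
    (hc : ∀ k < n, trig n (trigDeriv n T) (c k) = 0) (hc1 : ∀ k < n, 1 ≤ (trig n T (c k)).re ^ 2)
    {μ τ : ℝ} (hμ : 0 ≤ μ) (hτ0 : 0 < τ) (hτ1 : τ ≤ 1) {z : ℂ} (hz : z ∈ upperHalf) :
    trig n T z ^ 2 - μ * trig n (trigDeriv n T) z ^ 2 ≠ τ ^ 2 := by
  intro heq
  set D := trigDeriv n T with hD
  -- `R(exp (i z)) = exp (i n z) (t^2 - μ t'^2 - τ^2)`. On the real line the last factor is negative
  -- at zeros of `t` and at least `1 - τ^2` at the `c k`.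
  set R : ℂ[X] := T ^ 2 - C (μ : ℂ) * D ^ 2 - C ((τ : ℂ) ^ 2) * X ^ n with hR
  have hpow : ∀ z : ℂ, exp (I * z) ^ n = exp (I * n * z / 2) ^ 2 := by
    intro z
    rw [← exp_nat_mul, ← exp_nat_mul]; congr 1; push_cast; ring
  have hRz : ∀ z : ℂ, R.eval (exp (I * z)) =
      exp (I * z) ^ n * (trig n T z ^ 2 - μ * trig n D z ^ 2 - τ ^ 2) := by
    intro z
    simp only [hR, eval_sub, eval_mul, eval_pow, eval_C, eval_X]
    rw [← exp_mul_trig n T, ← exp_mul_trig n D, hpow]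
    ring
  have hRdeg : R.natDegree ≤ 2 * n := by
    refine (natDegree_sub_le _ _).trans (max_le ((natDegree_sub_le _ _).trans (max_le ?_ ?_)) ?_)
    · exact natDegree_pow_le.trans (by gcongr)
    · refine (natDegree_C_mul_le _ _).trans (natDegree_pow_le.trans ?_)
      have := natDegree_trigDeriv_le hT
      gcongr
    · exact (natDegree_C_mul_X_pow_le _ _).trans (by omega)
  set f : ℝ → ℝ := fun x => (trig n T x).re ^ 2 - μ * (trig n D x).re ^ 2 - τ ^ 2 with hf
  have hfC : ∀ x : ℝ, ((f x : ℝ) : ℂ) = trig n T x ^ 2 - μ * trig n D x ^ 2 - τ ^ 2 := by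
    intro x
    rw [← ofReal_trig_re hreal x, ← ofReal_trig_re (trigDeriv_real hreal) x]
    simp only [hf]; push_cast; rfl
  have hfc : Continuous f := by
    have h1 := continuous_re.comp ((continuous_trig n T).comp continuous_ofReal)
    have h2 := continuous_re.comp ((continuous_trig n D).comp continuous_ofReal)
    exact ((h1.pow 2).sub ((h2.pow 2).const_mul μ)).sub continuous_const
  have hneg : ∀ x : ℝ, trig n T x = 0 → f x < 0 := by
    intro x hx
    simp only [hf, hx, zero_re]
    have := mul_nonneg hμ (sq_nonneg (trig n D x).re)
    have := pow_pos hτ0 2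
    linarith
  have hnorm := h.norm_eq_one_of_eval_eq_zero hn hRdeg hfc
    (fun x => by rw [hfC]; exact hRz x) (fun k hk => hneg _ (hl k hk)) (fun k hk => hneg _ (hr k hk))
    (fun k hk => ?_) (fun k hk h0 => ?_) (w := exp (I * z)) (by rw [hRz, heq]; simp)
  · rw [norm_exp] at hnorm
    have h0 : 0 < z.im := hz
    have := Real.exp_eq_one_iff _ |>.1 hnorm
    simp at this
    linarith
  · simp only [hf, hc k hk, zero_re]
    have := hc1 k hk
    have : τ ^ 2 ≤ 1 := pow_le_one₀ hτ0.le hτ1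
    linarith
  -- The derivative of `t^2 - μ t'^2` contains the factor `t'`, so a zero at the critical point `c
  -- k` is double.
  · have h1 : HasDerivAt (fun z : ℂ => exp (I * z)) (exp (I * (c k : ℂ)) * I) (c k : ℂ) := by
      simpa using ((hasDerivAt_id (c k : ℂ)).const_mul I).cexp
    have h2 := (R.hasDerivAt (exp (I * (c k : ℂ)))).comp (c k : ℂ) h1
    have h3 := (h1.pow n).mul ((((hasDerivAt_trig n T (c k)).pow 2).sub
      (((hasDerivAt_trig n D (c k)).pow 2).const_mul (μ : ℂ))).sub_const ((τ : ℂ) ^ 2))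
    have h4 := h2.unique (h3.congr_of_eventuallyEq (Eventually.of_forall fun z => hRz z))
    have h5 : trig n T (c k) ^ 2 - μ * trig n D (c k) ^ 2 - τ ^ 2 = 0 := by rw [← hfC, h0, ofReal_zero]
    have h6 := hc k hk
    refine (mul_eq_zero.1 (h4.trans ?_)).resolve_right (mul_ne_zero (exp_ne_zero _) I_ne_zero)
    simp only [Pi.sub_apply, Pi.pow_apply]
    rw [h5, h6]
    simp

/-! ### From alternation to the comb function -/

/-- A differentiable function vanishing at the ends of an interval with a single critical point,
which takes a positive value, increases up to the critical point and decreases after it. -/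
theorem strictMonoOn_strictAntiOn_of_deriv {g g' : ℝ → ℝ} (hg : ∀ x, HasDerivAt g (g' x) x)
    {l c r x : ℝ} (hlc : l < c) (hcr : c < r) (hl : g l = 0) (hr : g r = 0)
    (h0 : ∀ y ∈ Ioo l r, g' y = 0 → y = c) (hx : x ∈ Ioo l r) (hgx : 0 < g x) :
    StrictMonoOn g (Icc l c) ∧ StrictAntiOn g (Icc c r) := by
  have hc : Continuous g := continuous_iff_continuousAt.2 fun x => (hg x).continuousAt
  -- Rolle: without critical points inside, `g` is injective, hence strictly monotone; its positive
  -- value at `x` fixes the directions.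
  have hinj : ∀ u v, l ≤ u → v ≤ r → (∀ y ∈ Ioo u v, y ≠ c) → InjOn g (Icc u v) := by
    intro u v hu hv hne
    have key : ∀ y ∈ Icc u v, ∀ y' ∈ Icc u v, y < y' → g y ≠ g y' := by
      intro y hy y' hy' hlt heq
      obtain ⟨w, hw, hw0⟩ := exists_hasDerivAt_eq_zero hlt hc.continuousOn heq fun w _ => hg w
      have hwm : w ∈ Ioo u v := ⟨hy.1.trans_lt hw.1, hw.2.trans_le hy'.2⟩
      exact hne w hwm (h0 w ⟨hu.trans_lt hwm.1, hwm.2.trans_le hv⟩ hw0)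
    intro y hy y' hy' heq
    rcases lt_trichotomy y y' with h | h | h
    · exact absurd heq (key y hy y' hy' h)
    · exact h
    · exact absurd heq.symm (key y' hy' y hy h)
  have h1 := hc.continuousOn.strictMonoOn_of_injOn_Icc' hlc.le
    (hinj l c le_rfl hcr.le fun y hy => hy.2.ne)
  have h2 := hc.continuousOn.strictMonoOn_of_injOn_Icc' hcr.le
    (hinj c r hlc.le le_rfl fun y hy => hy.1.ne')
  have hlm : l ∈ Icc l c := left_mem_Icc.2 hlc.le
  have hcm : c ∈ Icc l c := right_mem_Icc.2 hlc.le
  have hcm' : c ∈ Icc c r := left_mem_Icc.2 hcr.le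
  have hrm : r ∈ Icc c r := right_mem_Icc.2 hcr.le
  have hgc : 0 < g c := by
    rcases le_total x c with hxc | hxc
    · have hxm : x ∈ Icc l c := ⟨hx.1.le, hxc⟩
      rcases h1 with h1 | h1
      · exact hl ▸ h1 hlm hcm hlc
      · have := h1 hlm hxm hx.1
        linarith
    · have hxm : x ∈ Icc c r := ⟨hxc, hx.2.le⟩
      rcases h2 with h2 | h2
      · have := h2 hxm hrm hx.2
        linarith
      · exact hr ▸ h2 hcm' hrm hcr
  refine ⟨h1.resolve_right fun h => ?_, h2.resolve_left fun h => ?_⟩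
  · have := h hlm hcm hlc
    linarith
  · have := h hcm' hrm hcr
    linarith

/-- A real trigonometric function of degree `n / 2` that alternates between `1` and `-1` at `n + 1`
points outside of the gap `(a, b)` and is bounded by one at `a` and `b` has a comb function. -/
theorem exists_isCombMap_of_alternation {n : ℕ} (hn : 1 ≤ n) {T : ℂ[X]} (hT : T.natDegree ≤ n)
    (hreal : ∀ x : ℝ, (trig n T x).im = 0) {a b : ℝ} (hab : a < b) {x : ℕ → ℝ}
    (hxb : b ≤ x 0) (hxa : x n ≤ a + 2 * Real.pi) (hx : ∀ i < n, x i < x (i + 1))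
    (halt : ∀ i ≤ n, (trig n T (x i)).re = (-1) ^ i)
    (ha1 : (trig n T a).re ≤ 1) (hb1 : (trig n T b).re ≤ 1) :
    ∃ θ : ℂ → ℂ, IsCombMap n a b θ ∧
      ∀ z ∈ upperHalf, trig n T z = Complex.cos ((n : ℂ) / 2 * θ z) := by
  have hpi := Real.pi_pos
  set g : ℝ → ℝ := fun x => (trig n T x).re with hg
  set g' : ℝ → ℝ := fun x => (trig n (trigDeriv n T) x).re with hg'
  have hder : ∀ x, HasDerivAt g (g' x) x := hasDerivAt_trig_re n T
  have hgc : Continuous g := continuous_iff_continuousAt.2 fun x => (hder x).continuousAt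
  have hgt : ∀ x : ℝ, ((g x : ℝ) : ℂ) = trig n T x := ofReal_trig_re hreal
  have hgt' : ∀ x : ℝ, ((g' x : ℝ) : ℂ) = trig n (trigDeriv n T) x :=
    ofReal_trig_re (trigDeriv_real hreal)
  have hshift : ∀ y : ℝ, g (y - 2 * Real.pi) = (-1) ^ n * g y := by
    intro y
    have h1 := trig_add_two_pi n T ((y - 2 * Real.pi : ℝ) : ℂ)
    have h2 : ((y - 2 * Real.pi : ℝ) : ℂ) + 2 * Real.pi = y := by push_cast; ring
    rw [h2, ← hgt, ← hgt] at h1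
    have h3 : g y = (-1) ^ n * g (y - 2 * Real.pi) := by exact_mod_cast h1
    rw [h3, ← mul_assoc, ← mul_pow]; norm_num
  have hx0 : g (x 0) = 1 := by simpa using halt 0 (Nat.zero_le n)
  have hxn : g (x n - 2 * Real.pi) = 1 := by
    rw [hshift]
    have : g (x n) = (-1) ^ n := halt n le_rfl
    rw [this, ← mul_pow]; norm_num
  -- zeros between the points of alternation
  have hz : ∀ k < n, ∃ z ∈ Ioo (x k) (x (k + 1)), g z = 0 := by
    intro k hk
    have h1 : g (x k) = (-1) ^ k := halt k hk.le
    have h2 : g (x (k + 1)) = -(-1) ^ k := by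
      have : g (x (k + 1)) = (-1) ^ (k + 1) := halt (k + 1) hk
      rw [this, pow_succ]; ring
    rcases neg_one_pow_eq_or ℝ k with h | h
    · exact intermediate_value_Ioo' (hx k hk).le hgc.continuousOn (by rw [h1, h2, h]; norm_num)
    · exact intermediate_value_Ioo (hx k hk).le hgc.continuousOn (by rw [h1, h2, h]; norm_num)
  choose! z hzm hz0 using hz
  have hzlt : ∀ k k', k < k' → k' < n → z k < z k' := by
    intro k k' hkk
    induction k', hkk using Nat.le_induction with
    | base => exact fun h => (hzm k (by omega)).2.trans (hzm (k + 1) h).1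
    | succ m hm ih => exact fun h => (ih (by omega)).trans ((hzm m (by omega)).2.trans (hzm (m + 1) h).1)
  have hzle : ∀ k k', k ≤ k' → k' < n → z k ≤ z k' := by
    intro k k' hkk hk'
    rcases hkk.eq_or_lt with rfl | h
    · exact le_rfl
    · exact (hzlt k k' h hk').le
  -- The arcs run between consecutive zeros of `t`; the first starts at the last zero moved back by
  -- a period. It contains both `x 0` and `x n - 2π`, hence the gap.
  set L : ℝ := z (n - 1) - 2 * Real.pi with hL
  set l : ℕ → ℝ := fun k => if k = 0 then L else z (k - 1) with hl
  have hn1 : n - 1 < n := by omega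
  have hzlast : z (n - 1) < x n := by
    have := (hzm (n - 1) hn1).2
    rwa [Nat.sub_add_cancel hn] at this
  have hz0lo : x 0 < z 0 := (hzm 0 (by omega)).1
  have hLx : L < x n - 2 * Real.pi := by linarith
  have hlx : ∀ k < n, l k < x k ∧ x k < z k := by
    intro k hk
    refine ⟨?_, (hzm k hk).1⟩
    rcases Nat.eq_zero_or_pos k with rfl | h
    · simp only [hl, if_true]; linarith
    · simp only [hl, h.ne', if_false]
      have := (hzm (k - 1) (by omega)).2
      rwa [Nat.sub_add_cancel h] at this
  have hgL : g L = 0 := by rw [hL, hshift, hz0 _ hn1, mul_zero]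
  have hgl : ∀ k < n, g (l k) = 0 := by
    intro k hk
    by_cases h : k = 0
    · simp only [hl, h, if_true, hgL]
    · simp only [hl, h, if_false]; exact hz0 _ (by omega)
  -- critical points
  have hcrit : ∀ k < n, ∃ c, c ∈ Ioo (l k) (z k) ∧ g' c = 0 ∧ 1 ≤ g c ^ 2 := by
    intro k hk
    have hlz := (hlx k hk).1.trans (hlx k hk).2
    -- A maximum of `t^2` on the arc is at least its value `1` at `x k`, so it is interior and is a
    -- critical point of `t` itself.
    obtain ⟨c, hc, hmax⟩ := isCompact_Icc.exists_isMaxOn (nonempty_Icc.2 hlz.le)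
      (hgc.pow 2).continuousOn
    have hxk : g (x k) ^ 2 = 1 := by
      have : g (x k) = (-1) ^ k := halt k hk.le
      rw [this, ← pow_mul, mul_comm, pow_mul]; norm_num
    have hc1 : 1 ≤ g c ^ 2 := hxk ▸ hmax (⟨(hlx k hk).1.le, (hlx k hk).2.le⟩ : x k ∈ Icc (l k) (z k))
    have hc0 : g c ≠ 0 := fun h => by rw [h] at hc1; norm_num at hc1
    have hcl : c ≠ l k := fun h => hc0 (h ▸ hgl k hk)
    have hcz : c ≠ z k := fun h => hc0 (h ▸ hz0 k hk)
    have hcI : c ∈ Ioo (l k) (z k) := ⟨lt_of_le_of_ne hc.1 hcl.symm, lt_of_le_of_ne hc.2 hcz⟩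
    refine ⟨c, hcI, ?_, hc1⟩
    have h1 := (hmax.isLocalMax (Icc_mem_nhds hcI.1 hcI.2)).hasDerivAt_eq_zero ((hder c).pow 2)
    simpa [hc0] using h1
  choose! c hcm hc0 hc1 using hcrit
  have harc : IsArcSystem n L l z c := by
    refine ⟨fun k hk => hcm k hk, fun k hk => ⟨?_, ?_⟩, fun k k' hkk hk' => ?_⟩
    · by_cases h : k = 0
      · simp only [hl, h, if_true, le_refl]
      · simp only [hl, h, if_false]
        have := hzle 0 (k - 1) (by omega) (by omega)
        linarith
    · have := hzle k (n - 1) (by omega) hn1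
      simp only [hL]; linarith
    · have hk0 : k' ≠ 0 := by omega
      simp only [hl, hk0, if_false]
      exact hzle k (k' - 1) (by omega) (by omega)
  have hTl : ∀ k < n, trig n T (l k) = 0 := fun k hk => by rw [← hgt, hgl k hk, ofReal_zero]
  have hTz : ∀ k < n, trig n T (z k) = 0 := fun k hk => by rw [← hgt, hz0 k hk, ofReal_zero]
  have hTc : ∀ k < n, trig n (trigDeriv n T) (c k) = 0 := fun k hk => by
    rw [← hgt', hc0 k hk, ofReal_zero]
  -- the zeros of `T` and of its derivative polynomial
  have hT0 : T ≠ 0 := by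
    rintro rfl
    simp [hg, trig] at hx0
  have hD0 : trigDeriv n T ≠ 0 := by
    intro h
    obtain ⟨w, -, hw⟩ := exists_hasDerivAt_eq_slope g g' (hx 0 (by omega)) hgc.continuousOn
      fun w _ => hder w
    have h1 : g (x 1) = -1 := by simpa using halt 1 hn
    have h2 : g' w = 0 := by simp [hg', h, trig]
    rw [h2, zero_add, h1, hx0, eq_comm, div_eq_zero_iff] at hw
    have h01 : x 0 < x 1 := hx 0 (by omega)
    rcases hw with hw | hw
    · norm_num at hw
    · linarith
  have hzinj : ∀ k < n, ∀ k' < n, k ≠ k' → circlePt (z k) ≠ circlePt (z k') := by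
    intro k hk k' hk' hne heq
    have h1 := harc.window k hk
    have h2 := harc.window k' hk'
    have h3 := (hlx k hk).1.trans (hlx k hk).2
    have h4 := (hlx k' hk').1.trans (hlx k' hk').2
    have h5 := circlePt_inj heq (by rw [abs_lt]; constructor <;> linarith)
    rcases lt_or_gt_of_ne hne with h | h
    · exact (hzlt k k' h hk').ne h5
    · exact (hzlt k' k h hk).ne h5.symm
  have hrootT := fun w hw => exists_eq_circlePt_of_eval_eq_zero hT hT0
    (fun k hk => trig_ofReal_eq_zero_iff.1 (hTz k hk)) hzinj (w := w) hw
  have hrootD := fun w hw => exists_eq_circlePt_of_eval_eq_zero (natDegree_trigDeriv_le hT) hD0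
    (fun k hk => trig_ofReal_eq_zero_iff.1 (hTc k hk))
    (fun k hk k' hk' hne => harc.circlePt_ne hk hk' hne (hcm k hk) (hcm k' hk')) (w := w) hw
  have hupnorm : ∀ z ∈ upperHalf, ‖exp (I * z)‖ ≠ 1 := by
    intro z hz h
    rw [norm_exp, Real.exp_eq_one_iff] at h
    have h0 : 0 < z.im := hz
    simp at h
    linarith
  have hTeval0 : T.eval 0 ≠ 0 := by
    intro h
    obtain ⟨k, -, hk⟩ := hrootT 0 h
    exact circlePt_ne_zero _ hk.symm
  have hDup : ∀ z ∈ upperHalf, trig n (trigDeriv n T) z ≠ 0 := by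
    intro z hz h
    obtain ⟨k, -, hk⟩ := hrootD _ (trig_eq_zero_iff.1 h)
    exact hupnorm z hz (hk ▸ norm_circlePt _)
  have hne := fun μ τ (hμ : 0 ≤ μ) (hτ0 : 0 < τ) (hτ1 : τ ≤ 1) z (hz : z ∈ upperHalf) =>
    trig_sq_sub_ne hn hT hreal harc hTl hTz hTc hc1 hμ hτ0 hτ1 hz
  have hseg : ∀ z ∈ upperHalf, ∀ τ : ℝ, |τ| ≤ 1 → trig n T z ≠ τ := by
    intro w hw τ hτ heq
    rcases (abs_nonneg τ).eq_or_lt with h | h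
    · rw [abs_eq_zero.1 h.symm, ofReal_zero] at heq
      obtain ⟨k, -, hk⟩ := hrootT _ (trig_eq_zero_iff.1 heq)
      exact hupnorm w hw (hk ▸ norm_circlePt _)
    · refine hne 0 |τ| le_rfl h hτ w hw ?_
      rw [heq, ofReal_zero, zero_mul, sub_zero, ← ofReal_pow, ← ofReal_pow, sq_abs]
  have hslit : ∀ z ∈ upperHalf,
      trig n (trigDeriv n T) z ^ 2 / (1 - trig n T z ^ 2) ∈ slitPlane := by
    intro w hw
    have hden : 1 - trig n T w ^ 2 ≠ 0 := by
      intro h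
      refine hne 0 1 le_rfl one_pos le_rfl w hw ?_
      simp only [ofReal_zero, zero_mul, sub_zero, ofReal_one, one_pow]
      linear_combination -h
    by_contra hcon
    rw [mem_slitPlane_iff, not_or, not_lt, not_not] at hcon
    set G := trig n (trigDeriv n T) w ^ 2 / (1 - trig n T w ^ 2) with hG
    have hGre : G = ((G.re : ℝ) : ℂ) := Complex.ext rfl (by simpa using hcon.2)
    have hG0 : G ≠ 0 := div_ne_zero (pow_ne_zero 2 (hDup w hw)) hden
    have hGneg : G.re < 0 := lt_of_le_of_ne hcon.1 fun h => hG0 (by rw [hGre, h, ofReal_zero])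
    -- If `G = t'^2 / (1 - t^2)` were negative, `μ = -1/G` would give `t^2 - μ t'^2 = 1`.
    refine hne (-(G.re)⁻¹) 1 (by rw [neg_nonneg]; exact (inv_lt_zero.2 hGneg).le) one_pos le_rfl w hw ?_
    push_cast
    rw [← hGre]
    have h1 : G * (1 - trig n T w ^ 2) = trig n (trigDeriv n T) w ^ 2 := div_mul_cancel₀ _ hden
    rw [← h1]
    field_simp
    ring
  -- behaviour on the gap
  have hn0 : 0 < n := hn
  have hcm0 := hcm 0 hn0
  have hl0 : l 0 = L := by simp [hl]
  rw [hl0] at hcm0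
  have hLz : ∀ y ∈ Ioo L (z 0), g' y = 0 → y = c 0 := by
    intro y hy hy0
    obtain ⟨k, hk, hyk⟩ := hrootD _ (trig_ofReal_eq_zero_iff.1
      (show trig n (trigDeriv n T) y = 0 by rw [← hgt', hy0, ofReal_zero]))
    rcases Nat.eq_zero_or_pos k with rfl | h
    · have h1 := harc.window 0 hn0
      exact circlePt_inj hyk (by rw [abs_lt]; constructor <;> linarith [hy.1, hy.2, hcm0.1, hcm0.2])
    · exact absurd hyk (harc.circlePt_ne hn0 hk h.ne (by rw [hl0]; exact hy) (hcm k hk))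
  obtain ⟨hmono, hanti⟩ := strictMonoOn_strictAntiOn_of_deriv hder hcm0.1 hcm0.2 hgL (hz0 0 hn0) hLz
    (x := x 0) ⟨by linarith, hz0lo⟩ (by rw [hx0]; exact one_pos)
  -- On the first arc `t` rises to `c 0` and then falls, so it exceeds `1` strictly between its two
  -- points with value `1`. As `t ≤ 1` at `a` and `b`, these points must be `a` and `b`.
  have hgt1 : ∀ y, x n - 2 * Real.pi < y → y < x 0 → 1 < g y := by
    intro y hy1 hy2
    rcases le_total y (c 0) with h | h
    · rw [← hxn]
      exact hmono ⟨by linarith, by linarith⟩ ⟨by linarith, h⟩ hy1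
    · rw [← hx0]
      exact hanti ⟨h, by linarith⟩ ⟨by linarith, by linarith⟩ hy2
  have hbx : b = x 0 := by
    by_contra hne
    have := hgt1 b (by linarith) (lt_of_le_of_ne hxb hne)
    exact absurd hb1 (not_le.2 this)
  have hax : a = x n - 2 * Real.pi := by
    by_contra hne
    have := hgt1 a (lt_of_le_of_ne (by linarith) (Ne.symm hne)) (by linarith)
    exact absurd ha1 (not_le.2 this)
  rw [← hax] at hxn hgt1 hLx
  rw [← hbx] at hx0 hgt1 hz0lo
  have hac : a < c 0 := by
    by_contra hcon
    have := hanti ⟨not_lt.1 hcon, by linarith⟩ ⟨by linarith [not_lt.1 hcon], hz0lo.le⟩ hab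
    linarith
  have hcb : c 0 < b := by
    by_contra hcon
    have := hmono ⟨hLx.le, hac.le⟩ ⟨by linarith, not_lt.1 hcon⟩ hab
    linarith
  have ha' : 0 < g' a := by
    refine lt_of_le_of_ne ?_ fun h => hac.ne (hLz a ⟨hLx, by linarith⟩ h.symm)
    have h1 := hmono.monotoneOn.derivWithin_nonneg (x := a)
    rwa [derivWithin_of_mem_nhds (Icc_mem_nhds hLx hac), (hder a).deriv] at h1
  have hb' : g' b < 0 := by
    refine lt_of_le_of_ne ?_ fun h => hcb.ne' (hLz b ⟨by linarith, hz0lo⟩ h)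
    have h1 := hanti.antitoneOn.derivWithin_nonpos (x := b)
    rwa [derivWithin_of_mem_nhds (Icc_mem_nhds hcb hz0lo), (hder b).deriv] at h1
  exact exists_isCombMap hn hTeval0 hreal hseg hslit hab (by rw [← hgt, hxn, ofReal_one])
    (by rw [← hgt, hx0, ofReal_one]) (fun y hy => hgt1 y hy.1 hy.2) ha' hb'

/-! ### Alternating chains or few sign changes -/

/-- An increasing sequence of `N + 1` points lying alternately in `A` and in `B`. -/
def IsAltChain (N : ℕ) (A B : Set ℝ) (x : ℕ → ℝ) : Prop :=
  (∀ i < N, x i < x (i + 1)) ∧ ∀ i ≤ N, (Even i → x i ∈ A) ∧ (¬ Even i → x i ∈ B)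

lemma IsAltChain.cons {N : ℕ} {A B : Set ℝ} {x : ℕ → ℝ} (h : IsAltChain N B A x) {α : ℝ}
    (hα : α ∈ A) (hlt : α < x 0) : IsAltChain (N + 1) A B (fun i => Nat.casesOn i α x) := by
  constructor
  · rintro (_ | i) hi
    · exact hlt
    · exact h.1 i (by omega)
  · rintro (_ | i) hi
    · exact ⟨fun _ => hα, fun h => absurd Even.zero h⟩
    · have := h.2 i (by omega)
      rw [Nat.even_add_one, not_not]
      exact ⟨this.2, this.1⟩

/-- Two disjoint compact sets are separated by the sign changes of a real-rooted polynomial of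
degree at most `N`, unless there are `N + 1` points lying alternately in the one and the other. -/
theorem exists_isAltChain_or_separated (N : ℕ) : ∀ {l r : ℝ} {A B : Set ℝ}, IsCompact A →
    IsCompact B → Disjoint A B → A ⊆ Ioo l r → B ⊆ Ioo l r →
    (∃ x, IsAltChain N A B x) ∨ ∃ M ≤ N, ∃ ξ : ℕ → ℝ, (∀ i < M, ξ i ∈ Ioo l r) ∧
      (∀ x ∈ A, ∏ i ∈ Finset.range M, (ξ i - x) < 0) ∧
      ∀ x ∈ B, 0 < ∏ i ∈ Finset.range M, (ξ i - x) := by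
  induction N with
  | zero =>
    intro l r A B _ _ _ _ _
    rcases A.eq_empty_or_nonempty with rfl | ⟨a, ha⟩
    · exact Or.inr ⟨0, le_rfl, fun _ => 0, by simp, by simp, by simp⟩
    · exact Or.inl ⟨fun _ => a, by simp, fun i hi => by simp [Nat.le_zero.1 hi, ha]⟩
  | succ N ih =>
    intro l r A B hA hB hAB hAl hBl
    rcases A.eq_empty_or_nonempty with rfl | hne
    · exact Or.inr ⟨0, Nat.zero_le _, fun _ => 0, by simp, by simp, by simp⟩
    obtain ⟨α, hα, hαmin⟩ := hA.exists_isLeast hne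
    have hαB : α ∉ B := fun h => hAB.notMem_of_mem_left hα h
    -- `l'` cuts just below the least point of `A`. The induction exchanges the roles of `A` and the
    -- part of `B` beyond `l'`; a chain found there can be preceded by `α`.
    obtain ⟨l', hl', hl'B⟩ : ∃ l' ∈ Ioo l α, ∀ x ∈ B, l' ≤ x → α < x := by
      obtain ⟨δ, hδ, hδB⟩ := Metric.isOpen_iff.1 hB.isClosed.isOpen_compl α hαB
      refine ⟨max ((l + α) / 2) (α - δ / 2), ⟨?_, ?_⟩, fun x hx hlx => ?_⟩
      · exact lt_of_lt_of_le (by linarith [(hAl hα).1]) (le_max_left _ _)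
      · exact max_lt (by linarith [(hAl hα).1]) (by linarith)
      · by_contra hcon
        refine hδB (?_ : x ∈ Metric.ball α δ) hx
        have := (le_max_right _ _).trans hlx
        rw [Metric.mem_ball, Real.dist_eq, abs_lt]
        constructor <;> linarith [not_lt.1 hcon]
    rcases ih (l := l') (r := r) (hB.inter_right (isClosed_Ici (a := l'))) hA
      (hAB.symm.mono_left inter_subset_left)
      (fun x hx => ⟨hl'.2.trans (hl'B x hx.1 hx.2), (hBl hx.1).2⟩)
      (fun x hx => ⟨hl'.2.trans_le (hαmin hx), (hAl hx).2⟩) with ⟨x, hx⟩ | ⟨M, hM, ξ, hξ, hξB, hξA⟩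
    · left
      have h0 := (hx.2 0 (Nat.zero_le _)).1 Even.zero
      have h1 : IsAltChain N B A x := ⟨hx.1, fun i hi => ⟨fun h => ((hx.2 i hi).1 h).1, (hx.2 i hi).2⟩⟩
      exact ⟨_, h1.cons hα (hl'B _ h0.1 h0.2)⟩
    · right
      -- The new sign change `l'` is leftmost but stored last, since only the product matters. On
      -- points of `B` below `l'` all factors are positive.
      refine ⟨M + 1, by omega, Function.update ξ M l', ?_, ?_, ?_⟩
      · intro i hi
        rcases eq_or_ne i M with rfl | hiM
        · rw [Function.update_self]; exact ⟨hl'.1, hl'.2.trans (hAl hα).2⟩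
        · rw [Function.update_of_ne hiM]
          have := hξ i (by omega)
          exact ⟨hl'.1.trans this.1, this.2⟩
      all_goals
        intro x hx
        have hprod : ∏ i ∈ Finset.range (M + 1), (Function.update ξ M l' i - x) =
            (∏ i ∈ Finset.range M, (ξ i - x)) * (l' - x) := by
          rw [Finset.prod_range_succ, Function.update_self]
          congr 1
          refine Finset.prod_congr rfl fun i hi => ?_
          rw [Function.update_of_ne (Finset.mem_range.1 hi).ne]
        rw [hprod]
      · exact mul_neg_of_pos_of_neg (hξA x hx) (by linarith [hαmin hx, hl'.2])
      · rcases lt_or_ge x l' with h | h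
        · refine mul_pos (Finset.prod_pos fun i hi => ?_) (sub_pos.2 h)
          linarith [(hξ i (Finset.mem_range.1 hi)).1]
        · exact mul_pos_of_neg_of_neg (hξB x ⟨hx, h⟩) (by linarith [hl'B x hx h, hl'.2])

/-- When chains of `n` points exist starting in either set, the first point of the one that starts
earlier can be put before the other, giving `n + 1` points. This saves one sign change, so `M < n`.
-/
theorem exists_isAltChain_or_separated_symm {n : ℕ} (hn : 1 ≤ n) {l r : ℝ} {A B : Set ℝ}
    (hA : IsCompact A) (hB : IsCompact B) (hAB : Disjoint A B) (hAl : A ⊆ Ioo l r) (hBl : B ⊆ Ioo l r) :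
    (∃ x, IsAltChain n A B x) ∨ (∃ x, IsAltChain n B A x) ∨
    ∃ M < n, ∃ (σ : ℝ) (ξ : ℕ → ℝ), (∀ i < M, ξ i ∈ Ioo l r) ∧
      (∀ x ∈ A, 0 < σ * ∏ i ∈ Finset.range M, (ξ i - x)) ∧
      ∀ x ∈ B, σ * ∏ i ∈ Finset.range M, (ξ i - x) < 0 := by
  obtain ⟨N, rfl⟩ : ∃ N, n = N + 1 := ⟨n - 1, by omega⟩
  rcases exists_isAltChain_or_separated N hA hB hAB hAl hBl with ⟨x, hx⟩ | ⟨M, hM, ξ, h1, h2, h3⟩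
  · rcases exists_isAltChain_or_separated N hB hA hAB.symm hBl hAl with
      ⟨y, hy⟩ | ⟨M, hM, ξ, h1, h2, h3⟩
    · have hxA := (hx.2 0 (Nat.zero_le _)).1 Even.zero
      have hyB := (hy.2 0 (Nat.zero_le _)).1 Even.zero
      rcases lt_trichotomy (x 0) (y 0) with h | h | h
      · exact Or.inl ⟨_, hy.cons hxA h⟩
      · exact absurd hyB (h ▸ hAB.notMem_of_mem_left hxA)
      · exact Or.inr (Or.inl ⟨_, hx.cons hyB h⟩)
    · exact Or.inr (Or.inr ⟨M, by omega, 1, ξ, h1, by simpa using h3, by simpa using h2⟩)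
  · exact Or.inr (Or.inr ⟨M, by omega, -1, ξ, h1, by simpa using h2, by simpa using h3⟩)

/-- Within a period the half-angle sine has the sign of `x - ξ`, so real-rooted products and sine
products have the same sign pattern up to `(-1)^M`. -/
lemma exists_sin_half_sub_eq {x ξ : ℝ} (h : |x - ξ| < 2 * Real.pi) :
    ∃ H : ℝ, 0 < H ∧ Real.sin ((x - ξ) / 2) = -(ξ - x) * H := by
  have h' := abs_lt.1 h
  rcases lt_trichotomy (x - ξ) 0 with h0 | h0 | h0
  · have := Real.sin_neg_of_neg_of_neg_pi_lt (x := (x - ξ) / 2) (by linarith) (by linarith)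
    exact ⟨Real.sin ((x - ξ) / 2) / (x - ξ), div_pos_of_neg_of_neg this h0, by field_simp [h0.ne]; ring⟩
  · exact ⟨1, one_pos, by rw [h0, show ξ - x = 0 by linarith]; simp⟩
  · have := Real.sin_pos_of_pos_of_lt_pi (x := (x - ξ) / 2) (by linarith) (by linarith)
    exact ⟨Real.sin ((x - ξ) / 2) / (x - ξ), div_pos this h0, by field_simp [h0.ne']; ring⟩

lemma exists_prod_sin_eq {x : ℝ} {ξ : ℕ → ℝ} {M : ℕ} (h : ∀ i < M, |x - ξ i| < 2 * Real.pi) :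
    ∃ H : ℝ, 0 < H ∧ ∏ i ∈ Finset.range M, Real.sin ((x - ξ i) / 2) =
      (-1) ^ M * (∏ i ∈ Finset.range M, (ξ i - x)) * H := by
  induction M with
  | zero => exact ⟨1, one_pos, by simp⟩
  | succ M ih =>
    obtain ⟨H, hH, he⟩ := ih fun i hi => h i (by omega)
    obtain ⟨H', hH', he'⟩ := exists_sin_half_sub_eq (h M (by omega))
    refine ⟨H * H', mul_pos hH hH', ?_⟩
    rw [Finset.prod_range_succ, Finset.prod_range_succ, he, he']
    ring

/-- Each factor `sin ((z - ξ)/2)` is `exp (-i z / 2)` times a linear polynomial in `exp (i z)`. -/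
theorem exists_trig_eq_prod_sin (ξ : ℕ → ℝ) (n : ℕ) : ∃ S : ℂ[X], S.natDegree ≤ n ∧
    ∀ z : ℂ, trig n S z = ∏ i ∈ Finset.range n, Complex.sin ((z - ξ i) / 2) := by
  induction n with
  | zero => exact ⟨1, by simp, fun z => by simp [trig]⟩
  | succ n ih =>
    obtain ⟨S, hS, hSz⟩ := ih
    refine ⟨S * (C (I / 2) * (C (exp (I * ξ n / 2)) - C (exp (-(I * ξ n / 2))) * X)), ?_, fun z => ?_⟩
    · refine natDegree_mul_le.trans (add_le_add hS ((natDegree_C_mul_le _ _).trans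
        ((natDegree_sub_le _ _).trans (max_le (by simp) ((natDegree_C_mul_le _ _).trans natDegree_X_le)))))
    · rw [Finset.prod_range_succ, ← hSz]
      simp only [trig, eval_mul, eval_sub, eval_C, eval_X]
      have h1 : exp (-(I * ((n + 1 : ℕ) : ℂ) * z / 2)) = exp (-(I * n * z / 2)) * exp (-(I * z / 2)) := by
        rw [← exp_add]; congr 1; push_cast; ring
      have h2 : exp (-(I * z / 2)) * exp (I * ξ n / 2) = exp (-((z - ξ n) / 2) * I) := by
        rw [← exp_add]; congr 1; ring
      have h3 : exp (-(I * z / 2)) * (exp (-(I * ξ n / 2)) * exp (I * z)) = exp ((z - ξ n) / 2 * I) := by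
        rw [← exp_add, ← exp_add]; congr 1; ring
      rw [h1, Complex.sin, ← h2, ← h3]
      ring

/-- If `t` is bounded by one on a compact set and `s` has the sign of `t` wherever `|t| = 1`, then
`t - ε s` has smaller norm for some `ε > 0`. -/
theorem exists_sub_mul_lt_one {K : Set ℝ} (hK : IsCompact K) {t s : ℝ → ℝ} (ht : Continuous t)
    (hs : Continuous s) (ht1 : ∀ x ∈ K, t x ^ 2 ≤ 1) (hst : ∀ x ∈ K, t x ^ 2 = 1 → 0 < s x * t x) :
    ∃ ε > 0, ∃ ρ, 0 < ρ ∧ ρ < 1 ∧ ∀ x ∈ K, |t x - ε * s x| ≤ ρ := by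
  -- By compactness a local check suffices: where `t^2 < 1`, continuity; where `t^2 = 1`, `(t -
  -- εs)^2 = t^2 - ε(2st - εs^2)` with the bracket positive nearby.
  have h1 : ∀ᶠ ε in 𝓝 (0 : ℝ), ∀ x ∈ K, x ∈ K → 0 < ε → (t x - ε * s x) ^ 2 < 1 := by
    refine hK.eventually_forall_of_forall_eventually (P := fun ε x => x ∈ K → 0 < ε →
      (t x - ε * s x) ^ 2 < 1) fun x hx => ?_
    rcases (ht1 x hx).lt_or_eq with h | h
    · have hc : Continuous fun q : ℝ × ℝ => (t q.2 - q.1 * s q.2) ^ 2 := by fun_prop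
      have := hc.continuousAt (x := ((0 : ℝ), x))
      filter_upwards [this.tendsto.eventually_lt_const (u := 1) (by simpa using h)] with q hq _ _ using hq
    · have hc : Continuous fun q : ℝ × ℝ => 2 * (s q.2 * t q.2) - q.1 * s q.2 ^ 2 := by fun_prop
      have := hc.continuousAt (x := ((0 : ℝ), x))
      filter_upwards [this.tendsto.eventually_const_lt (u := 0) (by simpa using hst x hx h)] with q hq hqK hq0
      have := ht1 q.2 hqK
      nlinarith [mul_pos hq0 hq]
  obtain ⟨δ, hδ, hδε⟩ := Metric.eventually_nhds_iff_ball.1 h1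
  have hε := hδε (δ / 2) (by
    rw [Metric.mem_ball, Real.dist_eq, sub_zero, abs_of_pos (half_pos hδ)]; linarith)
  refine ⟨δ / 2, half_pos hδ, ?_⟩
  rcases K.eq_empty_or_nonempty with rfl | hne
  · exact ⟨1 / 2, by norm_num, by norm_num, by simp⟩
  · obtain ⟨y, hy, hmax⟩ := hK.exists_isMaxOn hne
      (f := fun x => |t x - δ / 2 * s x|) (by fun_prop)
    have hy1 : |t y - δ / 2 * s y| < 1 := by
      rw [← sq_lt_one_iff_abs_lt_one]; exact hε y hy hy (half_pos hδ)
    -- The `1/2` keeps `ρ` positive, so that it can be divided by.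
    refine ⟨max |t y - δ / 2 * s y| (1 / 2), by positivity, max_lt hy1 (by norm_num), fun x hx => ?_⟩
    exact (hmax hx).trans (le_max_left _ _)

/-! ### Alternation of real extremizers -/

section Alternation

variable {n : ℕ} {E : Set ℂ} {a b c : ℝ}

lemma norm_trig_ofReal (n : ℕ) (T : ℂ[X]) (x : ℝ) : ‖trig n T x‖ = ‖T.eval (circlePt x)‖ := by
  rw [trig, norm_mul, ← circlePt, norm_exp]
  have : (-(I * n * x / 2)).re = 0 := by
    rw [show -(I * n * x / 2) = ((-(n * x / 2) : ℝ) : ℂ) * I by push_cast; ring, re_ofReal_mul, I_re, mul_zero]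
  rw [this, Real.exp_zero, one_mul]

/-- The closed complementary arc of a gap of `E` covers `E`. -/
lemma IsGap.exists_mem_Icc (hgap : IsGap E a b) (hET : E ⊆ Metric.sphere (0 : ℂ) 1) {ζ : ℂ} (hζ : ζ ∈ E) :
    ∃ x ∈ Icc b (a + 2 * Real.pi), circlePt x = ζ := by
  have hnorm : ‖ζ‖ = 1 := by simpa using hET hζ
  have h1 : circlePt ζ.arg = ζ := by
    have := norm_mul_exp_arg_mul_I ζ
    rwa [hnorm, ofReal_one, one_mul, mul_comm] at this
  set q := toIcoDiv Real.two_pi_pos b ζ.arg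
  have h2 := toIcoMod_mem_Ico Real.two_pi_pos b ζ.arg
  rw [← self_sub_toIcoDiv_zsmul] at h2
  have h3 : circlePt (ζ.arg - q • (2 * Real.pi)) = ζ := by
    have := circlePt_add_int_mul ζ.arg (-q)
    rw [h1] at this
    exact (congrArg circlePt (by rw [zsmul_eq_mul]; push_cast; ring)).trans this
  refine ⟨ζ.arg - q • (2 * Real.pi), ⟨h2.1, ?_⟩, h3⟩
  by_contra hcon
  -- An argument beyond `a + 2π`, moved back by a period, would lie in the gap.
  refine hgap.2.2.2 (ζ.arg - q • (2 * Real.pi) - 2 * Real.pi) ⟨by linarith, by linarith [h2.2]⟩ ?_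
  have := circlePt_add_int_mul (ζ.arg - q • (2 * Real.pi)) (-1)
  rw [h3] at this
  rw [show ζ.arg - q • (2 * Real.pi) - 2 * Real.pi =
    ζ.arg - q • (2 * Real.pi) + ((-1 : ℤ) : ℝ) * (2 * Real.pi) by push_cast; ring, this]
  exact hζ

/-- A real extremal trigonometric function alternates between `1` and `-1` at `n + 1` points
of `E`. -/
theorem IsExtremizer.exists_alternation (hn : 1 ≤ n) (hE : IsClosed E)
    (hET : E ⊆ Metric.sphere (0 : ℂ) 1) (hgap : IsGap E a b) (hc : c ∈ Ioo a b) {Q : ℂ[X]}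
    (hQ : IsExtremizer n E c Q) (hreal : ∀ x : ℝ, (trig n Q x).im = 0) :
    ∃ (x : ℕ → ℝ) (σ : ℝ), σ ^ 2 = 1 ∧ b ≤ x 0 ∧ x n ≤ a + 2 * Real.pi ∧ (∀ i < n, x i < x (i + 1)) ∧
      ∀ i ≤ n, circlePt (x i) ∈ E ∧ (trig n Q (x i)).re = σ * (-1) ^ i := by
  have hpi := Real.pi_pos
  set t : ℝ → ℝ := fun x => (trig n Q x).re with ht
  have htc : Continuous t := continuous_re.comp ((continuous_trig n Q).comp continuous_ofReal)
  have htQ : ∀ x : ℝ, ((t x : ℝ) : ℂ) = trig n Q x := ofReal_trig_re hreal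
  set K : Set ℝ := Icc b (a + 2 * Real.pi) ∩ circlePt ⁻¹' E with hK
  have hKc : IsCompact K := isCompact_Icc.inter_right (hE.preimage continuous_circlePt)
  have hKsub : K ⊆ Ioo c (c + 2 * Real.pi) := fun x hx =>
    ⟨hc.2.trans_le hx.1.1, lt_of_le_of_lt hx.1.2 (by linarith [hc.1])⟩
  have hnormt : ∀ x : ℝ, ‖Q.eval (circlePt x)‖ = |t x| := by
    intro x
    rw [← norm_trig_ofReal n, ← htQ, norm_real, Real.norm_eq_abs]
  have ht1 : ∀ x ∈ K, t x ^ 2 ≤ 1 := by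
    intro x hx
    rw [sq_le_one_iff_abs_le_one, ← hnormt]
    exact hQ.1.2 _ hx.2
  set A : Set ℝ := K ∩ t ⁻¹' {1} with hA
  set B : Set ℝ := K ∩ t ⁻¹' {-1} with hB
  have hAc : IsCompact A := hKc.inter_right (isClosed_singleton.preimage htc)
  have hBc : IsCompact B := hKc.inter_right (isClosed_singleton.preimage htc)
  have hAB : Disjoint A B := by
    rw [Set.disjoint_left]
    intro x hxA hxB
    have h1 : t x = 1 := hxA.2
    have h2 : t x = -1 := hxB.2
    linarith
  have hchain : ∀ (A' B' : Set ℝ) (σ : ℝ), σ ^ 2 = 1 → A' ⊆ K → B' ⊆ K → (∀ x ∈ A', t x = σ) →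
      (∀ x ∈ B', t x = -σ) → (∃ x, IsAltChain n A' B' x) →
      ∃ (x : ℕ → ℝ) (σ : ℝ), σ ^ 2 = 1 ∧ b ≤ x 0 ∧ x n ≤ a + 2 * Real.pi ∧
        (∀ i < n, x i < x (i + 1)) ∧
        ∀ i ≤ n, circlePt (x i) ∈ E ∧ (trig n Q (x i)).re = σ * (-1) ^ i := by
    rintro A' B' σ hσ hA' hB' htA htB ⟨x, hx, hxm⟩
    have hxK : ∀ i ≤ n, x i ∈ K ∧ t (x i) = σ * (-1) ^ i := by
      intro i hi
      by_cases hev : Even i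
      · rw [hev.neg_one_pow, mul_one]
        exact ⟨hA' ((hxm i hi).1 hev), htA _ ((hxm i hi).1 hev)⟩
      · rw [(Nat.not_even_iff_odd.1 hev).neg_one_pow, mul_neg_one]
        exact ⟨hB' ((hxm i hi).2 hev), htB _ ((hxm i hi).2 hev)⟩
    exact ⟨x, σ, hσ, (hxK 0 (Nat.zero_le n)).1.1.1, (hxK n le_rfl).1.1.2, hx,
      fun i hi => ⟨(hxK i hi).1.2, (hxK i hi).2⟩⟩
  rcases exists_isAltChain_or_separated_symm hn hAc hBc hAB (inter_subset_left.trans hKsub)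
    (inter_subset_left.trans hKsub) with h | h | ⟨M, hM, σ, ξ, hξ, hξA, hξB⟩
  · exact hchain A B 1 (by norm_num) inter_subset_left inter_subset_left (fun x hx => hx.2)
      (fun x hx => hx.2) h
  · exact hchain B A (-1) (by norm_num) inter_subset_left inter_subset_left (fun x hx => hx.2)
      (fun x hx => by rw [neg_neg]; exact hx.2) h
  exfalso
  obtain ⟨d, rfl⟩ : ∃ d, n = M + (d + 1) := ⟨n - M - 1, by omega⟩
  -- The remaining `n - M ≥ 1` zeros are all placed at `c`: the extra sines are positive on `K`, so
  -- they keep the sign pattern, and they make the perturbation vanish at `c`.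
  obtain ⟨S, hS, hSz⟩ := exists_trig_eq_prod_sin (fun i => if i < M then ξ i else c) (M + (d + 1))
  set p : ℝ → ℝ := fun x => (∏ i ∈ Finset.range M, Real.sin ((x - ξ i) / 2)) *
    Real.sin ((x - c) / 2) ^ (d + 1) with hp
  have hSp : ∀ x : ℝ, trig (M + (d + 1)) S x = ((p x : ℝ) : ℂ) := by
    intro x
    rw [hSz, Finset.prod_range_add]
    simp only [hp]
    push_cast
    congr 1
    · refine Finset.prod_congr rfl fun i hi => ?_
      rw [if_pos (Finset.mem_range.1 hi)]
    · simp
  set s : ℝ → ℝ := fun x => σ * (-1) ^ M * p x with hs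
  have hsc : Continuous s := by simp only [hs, hp]; fun_prop
  have hssign : ∀ x ∈ K, ∃ H : ℝ, 0 < H ∧ s x = σ * (∏ i ∈ Finset.range M, (ξ i - x)) * H := by
    intro x hx
    have hxI := hKsub hx
    obtain ⟨H, hH, he⟩ := exists_prod_sin_eq (x := x) (ξ := ξ) (M := M) fun i hi => by
      have := hξ i hi
      rw [abs_lt]; constructor <;> linarith [hxI.1, hxI.2, this.1, this.2]
    have hsin : 0 < Real.sin ((x - c) / 2) :=
      Real.sin_pos_of_pos_of_lt_pi (by linarith [hxI.1]) (by linarith [hxI.2])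
    refine ⟨H * Real.sin ((x - c) / 2) ^ (d + 1), by positivity, ?_⟩
    have h1 : ((-1 : ℝ) ^ M) * (-1) ^ M = 1 := by rw [← mul_pow]; norm_num
    simp only [hs, hp, he]
    linear_combination (σ * (∏ i ∈ Finset.range M, (ξ i - x)) * H * Real.sin ((x - c) / 2) ^ (d + 1)) * h1
  obtain ⟨ε, hε, ρ, hρ0, hρ1, hερ⟩ := exists_sub_mul_lt_one hKc htc hsc ht1 (by
    intro x hx hx1
    obtain ⟨H, hH, he⟩ := hssign x hx
    rw [he]
    rcases mul_self_eq_one_iff.1 ((sq (t x)).symm.trans hx1) with h | h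
    · rw [h, mul_one]; exact mul_pos (hξA x ⟨hx, h⟩) hH
    · rw [h, mul_neg_one, neg_pos]
      exact mul_neg_of_neg_of_pos (hξB x ⟨hx, h⟩) hH)
  -- The perturbed function is at most `ρ < 1` on `E` and unchanged at `c`. Dividing by `ρ` improves
  -- the value there, because comparison with the constant `1` shows `|t c| ≥ 1`.
  set R : ℂ[X] := C ((ρ⁻¹ : ℝ) : ℂ) * (Q - C ((ε * (σ * (-1) ^ M) : ℝ) : ℂ) * S) with hR
  have hRnorm : ∀ x : ℝ, ‖R.eval (circlePt x)‖ = ρ⁻¹ * |t x - ε * s x| := by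
    intro x
    have h1 : trig (M + (d + 1)) R x = ((ρ⁻¹ * (t x - ε * s x) : ℝ) : ℂ) := by
      have h2 : trig (M + (d + 1)) R x = ((ρ⁻¹ : ℝ) : ℂ) * (trig (M + (d + 1)) Q x -
          ((ε * (σ * (-1) ^ M) : ℝ) : ℂ) * trig (M + (d + 1)) S x) := by
        simp only [trig, hR, eval_mul, eval_sub, eval_C]; ring
      rw [h2, hSp, ← htQ]
      simp only [hs]; push_cast; ring
    rw [← norm_trig_ofReal (M + (d + 1)), h1, norm_real, Real.norm_eq_abs, abs_mul,
      abs_of_pos (inv_pos.2 hρ0)]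
  have hRb : R ∈ boundedPolys (M + (d + 1)) E := by
    refine ⟨(natDegree_C_mul_le _ _).trans ((natDegree_sub_le _ _).trans
      (max_le hQ.1.1 ((natDegree_C_mul_le _ _).trans hS))), fun ζ hζ => ?_⟩
    obtain ⟨x, hx, rfl⟩ := hgap.exists_mem_Icc hET hζ
    rw [hRnorm, inv_mul_le_iff₀ hρ0, mul_one]
    exact hερ x ⟨hx, hζ⟩
  have h1 := hQ.2 R hRb
  have hone : (1 : ℝ) ≤ |t c| := by
    have := hQ.2 1 ⟨by simp, fun ζ _ => by simp⟩
    rw [hnormt] at this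
    simpa using this
  have hsc0 : s c = 0 := by simp [hs, hp]
  rw [hRnorm, hsc0, mul_zero, sub_zero, hnormt, inv_mul_le_iff₀ hρ0] at h1
  nlinarith

end Alternation

/-! ### Real extremizers and existence -/

/-- The conjugate of a trigonometric function on the real line is a trigonometric function. -/
theorem exists_trig_eq_conj {n : ℕ} {P : ℂ[X]} (hP : P.natDegree ≤ n) :
    ∃ P' : ℂ[X], P'.natDegree ≤ n ∧ ∀ x : ℝ, trig n P' x = (starRingEnd ℂ) (trig n P x) := by
  -- For `|w| = 1`, `w^n conj (P w)` is the value at `w` of the reversed polynomial with conjugate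
  -- coefficients.
  refine ⟨reflect n (P.map (starRingEnd ℂ)), ?_, fun x => ?_⟩
  · exact natDegree_reflect_le.trans (max_le le_rfl ((natDegree_map_le).trans hP))
  · have hw : circlePt x ≠ 0 := circlePt_ne_zero x
    let _ : Invertible (circlePt x)⁻¹ := invertibleOfNonzero (inv_ne_zero hw)
    have h1 := eval₂_reflect_mul_pow (RingHom.id ℂ) (circlePt x)⁻¹ n (P.map (starRingEnd ℂ))
      (natDegree_map_le.trans hP)
    have hconj : (circlePt x)⁻¹ = (starRingEnd ℂ) (circlePt x) := by
      rw [inv_def, normSq_eq_norm_sq, norm_circlePt]; simp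
    rw [invOf_eq_inv, inv_inv, eval₂_id, eval₂_id] at h1
    conv_rhs at h1 => rw [hconj, eval_map_apply]
    have h2 : (starRingEnd ℂ) (exp (-(I * n * x / 2))) = exp (I * n * x / 2) := by
      rw [← exp_conj, show -(I * n * x / 2) = ((-(n * x / 2) : ℝ) : ℂ) * I by push_cast; ring,
        map_mul, conj_ofReal, conj_I]
      congr 1; push_cast; ring
    have h3 : exp (I * n * x / 2) = exp (-(I * n * x / 2)) * circlePt x ^ n := by
      rw [circlePt, ← exp_nat_mul, ← exp_add]; congr 1; ring
    rw [trig, trig, map_mul, h2, ← circlePt, ← h1, h3, inv_pow]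
    field_simp

/-- There is a real extremal trigonometric function if there is an extremal one. -/
theorem IsExtremizer.exists_real {n : ℕ} {E : Set ℂ} (hET : E ⊆ Metric.sphere (0 : ℂ) 1) {a b c : ℝ}
    (hgap : IsGap E a b) {P : ℂ[X]} (hP : IsExtremizer n E c P) :
    ∃ Q : ℂ[X], IsExtremizer n E c Q ∧ ∀ x : ℝ, (trig n Q x).im = 0 := by
  -- After this rotation, taking the real part loses nothing at `c` and does not increase the
  -- modulus elsewhere on the circle.
  obtain ⟨u, hu, hup⟩ : ∃ u : ℂ, ‖u‖ = 1 ∧ u * trig n P c = (‖trig n P c‖ : ℂ) := by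
    by_cases h : trig n P c = 0
    · exact ⟨1, by simp, by simp [h]⟩
    · refine ⟨(‖trig n P c‖ : ℂ) / trig n P c, ?_, div_mul_cancel₀ _ h⟩
      rw [norm_div, norm_real, norm_norm, div_self (norm_ne_zero_iff.2 h)]
  obtain ⟨P', hP', hPc⟩ := exists_trig_eq_conj ((natDegree_C_mul_le u P).trans hP.1.1)
  have huP : ∀ x : ℝ, trig n (C u * P) x = u * trig n P x := fun x => by
    simp only [trig, eval_mul, eval_C]; ring
  set Q : ℂ[X] := C (1 / 2 : ℂ) * (C u * P + P') with hQ
  have hQre : ∀ x : ℝ, trig n Q x = (((u * trig n P x).re : ℝ) : ℂ) := by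
    intro x
    have : trig n Q x = 1 / 2 * (trig n (C u * P) x + trig n P' x) := by
      simp only [trig, hQ, eval_mul, eval_add, eval_C]; ring
    rw [this, hPc, huP, add_conj]; push_cast; ring
  have hQle : ∀ x : ℝ, ‖Q.eval (circlePt x)‖ ≤ ‖P.eval (circlePt x)‖ := by
    intro x
    rw [← norm_trig_ofReal n, ← norm_trig_ofReal n, hQre, norm_real, Real.norm_eq_abs]
    refine (abs_re_le_norm _).trans ?_
    rw [norm_mul, hu, one_mul]
  refine ⟨Q, ⟨⟨?_, fun ζ hζ => ?_⟩, fun R hR => (hP.2 R hR).trans ?_⟩, fun x => by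
    rw [hQre, ofReal_im]⟩
  · exact (natDegree_C_mul_le _ _).trans ((natDegree_add_le _ _).trans
      (max_le ((natDegree_C_mul_le u P).trans hP.1.1) hP'))
  · obtain ⟨x, -, rfl⟩ := hgap.exists_mem_Icc hET hζ
    exact (hQle x).trans (hP.1.2 _ hζ)
  · rw [← norm_trig_ofReal n, ← norm_trig_ofReal n, hQre, hup, ofReal_re, norm_real, norm_norm]

/-- There is an extremizer if `E` has more than `n` points. -/
theorem exists_isExtremizer {n : ℕ} {E : Set ℂ} (hE : (n : ℕ∞) < E.encard) (c : ℝ) :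
    ∃ P : ℂ[X], IsExtremizer n E c P := by
  obtain ⟨s, hsE, hs⟩ := exists_subset_encard_eq (s := E) (k := ((n + 1 : ℕ) : ℕ∞))
    (by push_cast; exact Order.add_one_le_of_lt hE)
  have hfin : s.Finite := finite_of_encard_eq_coe hs
  have hcard : hfin.toFinset.card = n + 1 := by
    rw [hfin.encard_eq_coe_toFinset_card] at hs
    exact_mod_cast hs
  set S := hfin.toFinset with hS
  set e := S.equivFinOfCardEq hcard
  set v : Fin (n + 1) → ℂ := fun i => (e.symm i : ℂ) with hv
  have hvinj : Function.Injective v := Subtype.val_injective.comp e.symm.injective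
  have hvE : ∀ i, v i ∈ E := fun i => hsE (hfin.mem_toFinset.1 (e.symm i).2)
  have hinj : Set.InjOn v (Finset.univ : Finset (Fin (n + 1))) := hvinj.injOn
  -- The class is parametrized by values at `n + 1` nodes in `E`; the bound at the nodes makes the
  -- admissible set `V` compact.
  set F : (Fin (n + 1) → ℂ) → ℂ[X] := fun r => Lagrange.interpolate Finset.univ v r with hF
  have hFc : ∀ ζ : ℂ, Continuous fun r => ‖(F r).eval ζ‖ := by
    intro ζ
    simp only [hF, Lagrange.interpolate_apply, eval_finsetSum, eval_mul, eval_C]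
    fun_prop
  set V : Set (Fin (n + 1) → ℂ) := {r | ∀ ζ ∈ E, ‖(F r).eval ζ‖ ≤ 1} with hV
  have hVclosed : IsClosed V := by
    have : V = ⋂ ζ ∈ E, {r | ‖(F r).eval ζ‖ ≤ 1} := by ext r; simp [hV]
    rw [this]
    exact isClosed_biInter fun ζ _ => isClosed_le (hFc ζ) continuous_const
  have hVball : V ⊆ Metric.closedBall 0 1 := by
    intro r hr
    rw [mem_closedBall_zero_iff, pi_norm_le_iff_of_nonneg zero_le_one]
    intro i
    have := hr (v i) (hvE i)
    rwa [show (F r).eval (v i) = r i from Lagrange.eval_interpolate_at_node r hinj (Finset.mem_univ i)] at this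
  have hVc : IsCompact V := (isCompact_closedBall _ _).of_isClosed_subset hVclosed hVball
  obtain ⟨r, hr, hmax⟩ := hVc.exists_isMaxOn ⟨0, fun ζ _ => by simp [hF]⟩
    (hFc (circlePt c)).continuousOn
  have hdeg : ∀ P : ℂ[X], P.natDegree ≤ n → P.degree < ((Finset.univ : Finset (Fin (n + 1))).card : ℕ) := by
    intro P hP
    rw [Finset.card_univ, Fintype.card_fin]
    exact (degree_le_of_natDegree_le hP).trans_lt (by exact_mod_cast Nat.lt_succ_self n)
  refine ⟨F r, ⟨?_, hr⟩, fun Q hQ => ?_⟩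
  · have := Lagrange.degree_interpolate_le (r := r) hinj
    rw [Finset.card_univ, Fintype.card_fin] at this
    rw [Nat.add_sub_cancel] at this
    exact natDegree_le_of_degree_le this
  · have h1 : Q = F fun i => Q.eval (v i) := Lagrange.eq_interpolate hinj (hdeg Q hQ.1)
    have h2 : (fun i => Q.eval (v i)) ∈ V := by
      simp only [hV, mem_ofPred_eq, ← h1]; exact hQ.2
    have := hmax h2
    simp only [mem_ofPred_eq, ← h1] at this
    exact this

/-! ### Lagrange interpolation: extremality and uniqueness -/

lemma circlePt_sub_circlePt (x y : ℝ) :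
    circlePt x - circlePt y = exp (I * (x + y) / 2) * (2 * I) * (Real.sin ((x - y) / 2) : ℂ) := by
  rw [ofReal_sin, Complex.sin, circlePt, circlePt]
  have h1 : exp (I * x) = exp (I * (x + y) / 2) * exp (((x - y : ℝ) / 2 : ℝ) * I) := by
    rw [← exp_add]; congr 1; push_cast; ring
  have h2 : exp (I * y) = exp (I * (x + y) / 2) * exp (-(((x - y : ℝ) / 2 : ℝ)) * I) := by
    rw [← exp_add]; congr 1; push_cast; ring
  rw [h1, h2]
  linear_combination -(exp (I * (x + y) / 2) * (exp (-(((x - y : ℝ) / 2 : ℝ)) * I) -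
    exp (((x - y : ℝ) / 2 : ℝ) * I))) * I_mul_I

/-- The Lagrange basis polynomials of nodes on the circle, at a point of the circle which precedes
all nodes, alternate in sign up to a common rotation. -/
theorem eval_basis_circlePt {n : ℕ} {x : ℕ → ℝ} {c : ℝ} (hx : ∀ i j, i < j → j ≤ n → x i < x j)
    (hc : ∀ i ≤ n, x i ∈ Ioo c (c + 2 * Real.pi)) {i : ℕ} (hi : i ≤ n) :
    ∃ p : ℝ, 0 < p ∧ (Lagrange.basis (Finset.range (n + 1)) (fun j => circlePt (x j)) i).eval (circlePt c) =
      exp (I * n * (c - x i) / 2) * (((-1) ^ i * p : ℝ) : ℂ) := by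
  have hpi := Real.pi_pos
  set s := (Finset.range (n + 1)).erase i with hs
  have hcard : s.card = n := by
    rw [hs, Finset.card_erase_of_mem (Finset.mem_range.2 (by omega)), Finset.card_range]; rfl
  have hsm : ∀ j ∈ s, j ≠ i ∧ j ≤ n := fun j hj => by
    have := Finset.mem_erase.1 hj
    exact ⟨this.1, by have := Finset.mem_range.1 this.2; omega⟩
  set q : ℕ → ℝ := fun j => Real.sin ((c - x j) / 2) / Real.sin ((x i - x j) / 2) with hq
  -- All numerators `sin ((c - x j)/2)` are negative, and the denominator is positive exactly for `j
  -- < i`; the `i` such nodes give the sign `(-1)^i`.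
  set ε : ℕ → ℝ := fun j => if j < i then -1 else 1 with hε
  have hsin : ∀ j ≤ n, Real.sin ((c - x j) / 2) < 0 := fun j hj =>
    Real.sin_neg_of_neg_of_neg_pi_lt (by linarith [(hc j hj).1]) (by linarith [(hc j hj).2])
  have hxi := hc i hi
  have hqpos : ∀ j ∈ s, Real.sin ((x i - x j) / 2) ≠ 0 ∧ 0 < ε j * q j := by
    intro j hj
    obtain ⟨hji, hjn⟩ := hsm j hj
    have hxj := hc j hjn
    rcases lt_or_gt_of_ne hji with h | h
    · have h1 : 0 < Real.sin ((x i - x j) / 2) :=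
        Real.sin_pos_of_pos_of_lt_pi (by linarith [hx j i h hi]) (by linarith [hxi.2, hxj.1])
      refine ⟨h1.ne', ?_⟩
      simp only [hε, hq, if_pos h]
      have := div_neg_of_neg_of_pos (hsin j hjn) h1
      linarith
    · have h1 : Real.sin ((x i - x j) / 2) < 0 :=
        Real.sin_neg_of_neg_of_neg_pi_lt (by linarith [hx i j h hjn]) (by linarith [hxi.1, hxj.2])
      refine ⟨h1.ne, ?_⟩
      simp only [hε, hq, if_neg h.not_gt, one_mul]
      exact div_pos_of_neg_of_neg (hsin j hjn) h1
  have hεprod : ∏ j ∈ s, ε j = (-1) ^ i := by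
    simp only [hε]
    rw [Finset.prod_ite, Finset.prod_const, Finset.prod_const_one, mul_one]
    congr 1
    have : s.filter (fun j => j < i) = Finset.range i := by
      ext j
      simp only [hs, Finset.mem_filter, Finset.mem_erase, Finset.mem_range]
      omega
    rw [this, Finset.card_range]
  refine ⟨∏ j ∈ s, ε j * q j, Finset.prod_pos fun j hj => (hqpos j hj).2, ?_⟩
  have hfac : ∀ j ∈ s, (Lagrange.basisDivisor (circlePt (x i)) (circlePt (x j))).eval (circlePt c) =
      exp (I * (c - x i) / 2) * (q j : ℂ) := by
    intro j hj
    have h1 : ((Real.sin ((x i - x j) / 2) : ℝ) : ℂ) ≠ 0 := by exact_mod_cast (hqpos j hj).1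
    simp only [Lagrange.basisDivisor, eval_mul, eval_C, eval_sub, eval_X]
    rw [circlePt_sub_circlePt, circlePt_sub_circlePt]
    have h2 : exp (I * (c + x j) / 2) = exp (I * (c - x i) / 2) * exp (I * (x i + x j) / 2) := by
      rw [← exp_add]; congr 1; ring
    have h3 := exp_ne_zero (I * (x i + x j) / 2)
    rw [h2]
    simp only [hq, ofReal_div]
    field_simp [I_ne_zero]
  rw [Lagrange.basis, eval_prod, Finset.prod_congr rfl hfac, Finset.prod_mul_distrib,
    Finset.prod_const, hcard, ← exp_nat_mul, ← ofReal_prod, Finset.prod_mul_distrib, hεprod,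
    ← mul_assoc, ← mul_pow]
  congr 2
  · ring
  · norm_num

/-- A polynomial whose trigonometric function alternates at `n + 1` points of `E` outside of a gap
is, up to a unimodular constant, the only extremizer at all points of the gap. -/
theorem isExtremizer_iff_of_alternation {n : ℕ} {E : Set ℂ} {T : ℂ[X]} (hT : T ∈ boundedPolys n E)
    {x : ℕ → ℝ} (hx : ∀ i j, i < j → j ≤ n → x i < x j) (hxE : ∀ i ≤ n, circlePt (x i) ∈ E)
    (halt : ∀ i ≤ n, trig n T (x i) = (-1) ^ i) {c : ℝ}
    (hc : ∀ i ≤ n, x i ∈ Ioo c (c + 2 * Real.pi)) :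
    T.eval (circlePt c) = exp (I * n * c / 2) * (‖T.eval (circlePt c)‖ : ℂ) ∧
      ∀ Q : ℂ[X], IsExtremizer n E c Q ↔ ∃ v : ℂ, ‖v‖ = 1 ∧ Q = C v * T := by
  set s := Finset.range (n + 1) with hs
  have hsn : ∀ i ∈ s, i ≤ n := fun i hi => by have := Finset.mem_range.1 hi; omega
  set w : ℕ → ℂ := fun j => circlePt (x j) with hw
  set ℓ : ℕ → ℂ := fun i => (Lagrange.basis s w i).eval (circlePt c) with hℓ
  set e : ℂ := exp (I * n * c / 2) with he
  have he1 : ‖e‖ = 1 := by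
    rw [he, show I * n * c / 2 = ((n * c / 2 : ℝ) : ℂ) * I by push_cast; ring, norm_exp_ofReal_mul_I]
  have he0 : e ≠ 0 := exp_ne_zero _
  have hinj : Set.InjOn w s := by
    intro i hi j hj heq
    have hi := hsn i hi
    have hj := hsn j hj
    have h1 := hc i hi
    have h2 := hc j hj
    have h3 := circlePt_inj heq (by rw [abs_lt]; constructor <;> linarith [h1.1, h1.2, h2.1, h2.2])
    rcases lt_trichotomy i j with h | h | h
    · exact absurd h3 (hx i j h hj).ne
    · exact h
    · exact absurd h3 (hx j i h hi).ne'
  have hdeg : ∀ P : ℂ[X], P.natDegree ≤ n → P.degree < s.card := by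
    intro P hP
    rw [hs, Finset.card_range]
    exact (degree_le_of_natDegree_le hP).trans_lt (by exact_mod_cast Nat.lt_succ_self n)
  have hinterp : ∀ P : ℂ[X], P.natDegree ≤ n →
      P.eval (circlePt c) = ∑ i ∈ s, P.eval (w i) * ℓ i := by
    intro P hP
    conv_lhs => rw [Lagrange.eq_interpolate hinj (hdeg P hP), Lagrange.interpolate_apply]
    simp [eval_finsetSum, hℓ]
  -- The alternation of `T` cancels that of the basis polynomials, so all terms of the interpolation
  -- formula have the common phase `e`. Thus `T` attains the general bound `Λ = ∑ ‖ℓ i‖`.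
  have hTℓ : ∀ i ∈ s, ℓ i ≠ 0 ∧ T.eval (w i) * ℓ i = e * (‖ℓ i‖ : ℂ) := by
    intro i hi
    obtain ⟨p, hp, hpe⟩ := eval_basis_circlePt hx hc (hsn i hi)
    have h1 : ℓ i = exp (I * n * (c - x i) / 2) * (((-1) ^ i * p : ℝ) : ℂ) := hpe
    have hnorm : ‖ℓ i‖ = p := by
      rw [h1, norm_mul, show I * n * (c - x i) / 2 = ((n * (c - x i) / 2 : ℝ) : ℂ) * I by push_cast; ring,
        norm_exp_ofReal_mul_I, norm_real, Real.norm_eq_abs, abs_mul, abs_pow, abs_neg, abs_one, one_pow,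
        one_mul, one_mul, abs_of_pos hp]
    refine ⟨norm_pos_iff.1 (hnorm ▸ hp), ?_⟩
    have h2 : T.eval (w i) = exp (I * n * x i / 2) * (-1) ^ i := by
      rw [← halt i (hsn i hi), exp_mul_trig]; rfl
    have h3 : e = exp (I * n * x i / 2) * exp (I * n * (c - x i) / 2) := by
      rw [he, ← exp_add]; congr 1; ring
    have h4 : ((-1 : ℂ) ^ i) * (-1) ^ i = 1 := by rw [← mul_pow]; norm_num
    rw [hnorm, h2, h1, h3]
    push_cast
    linear_combination (exp (I * n * x i / 2) * exp (I * n * (c - x i) / 2) * p) * h4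
  set Λ : ℝ := ∑ i ∈ s, ‖ℓ i‖ with hΛ
  have hΛ0 : 0 < Λ := Finset.sum_pos (fun i hi => norm_pos_iff.2 (hTℓ i hi).1) ⟨0, by simp [hs]⟩
  have hTΛ : T.eval (circlePt c) = e * Λ := by
    rw [hinterp T hT.1, Finset.sum_congr rfl fun i hi => (hTℓ i hi).2, ← Finset.mul_sum, hΛ, ofReal_sum]
  have hTnorm : ‖T.eval (circlePt c)‖ = Λ := by
    rw [hTΛ, norm_mul, he1, one_mul, norm_real, Real.norm_of_nonneg hΛ0.le]
  have hle : ∀ Q ∈ boundedPolys n E, ∀ i ∈ s, ‖Q.eval (w i) * ℓ i‖ ≤ ‖ℓ i‖ := by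
    intro Q hQ i hi
    rw [norm_mul]
    exact mul_le_of_le_one_left (norm_nonneg _) (hQ.2 _ (hxE i (hsn i hi)))
  have hQΛ : ∀ Q ∈ boundedPolys n E, ‖Q.eval (circlePt c)‖ ≤ Λ := by
    intro Q hQ
    rw [hinterp Q hQ.1]
    exact norm_sum_le_of_le _ (hle Q hQ)
  refine ⟨by rw [hTnorm]; exact hTΛ, fun Q => ⟨fun hQ => ?_, ?_⟩⟩
  · have hQn : ‖Q.eval (circlePt c)‖ = Λ :=
      le_antisymm (hQΛ Q hQ.1) (hTnorm ▸ hQ.2 T hT)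
    set v : ℂ := Q.eval (circlePt c) / (e * Λ) with hv
    have hΛC : (Λ : ℂ) ≠ 0 := by exact_mod_cast hΛ0.ne'
    have hv1 : ‖v‖ = 1 := by
      rw [hv, norm_div, hQn, ← hTΛ, hTnorm, div_self hΛ0.ne']
    have hv0 : v ≠ 0 := norm_pos_iff.1 (by rw [hv1]; exact one_pos)
    have hve : v * e ≠ 0 := mul_ne_zero hv0 he0
    set p : ℕ → ℂ := fun i => Q.eval (w i) * ℓ i / (v * e) with hp
    have hpn : ∀ i ∈ s, ‖p i‖ ≤ ‖ℓ i‖ := by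
      intro i hi
      rw [hp, norm_div, norm_mul v e, hv1, he1, one_mul, div_one]
      exact hle Q hQ.1 i hi
    have hpsum : ∑ i ∈ s, p i = Λ := by
      simp only [hp]
      rw [← Finset.sum_div, ← hinterp Q hQ.1.1, div_eq_iff hve, hv]
      field_simp
    -- Equality in the triangle inequality: the rotated terms sum to `Λ`, so each must equal `‖ℓ
    -- i‖`. This fixes `Q` at `n + 1` nodes.
    have hre : ∀ i ∈ s, (p i).re = ‖ℓ i‖ := by
      refine (Finset.sum_eq_sum_iff_of_le fun i hi => (re_le_norm _).trans (hpn i hi)).1 ?_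
      rw [← re_sum, hpsum, ofReal_re]
    have hpl : ∀ i ∈ s, p i = (‖ℓ i‖ : ℂ) := by
      intro i hi
      have h1 : (p i).re = ‖p i‖ := le_antisymm (re_le_norm _) ((hpn i hi).trans (hre i hi).ge)
      have h2 := (nonneg_iff.1 (re_eq_norm.1 h1)).2
      exact Complex.ext (by rw [hre i hi, ofReal_re]) (by rw [← h2, ofReal_im])
    refine ⟨v, hv1, Polynomial.eq_of_degrees_lt_of_eval_index_eq s hinj (hdeg Q hQ.1.1)
      (hdeg _ ((natDegree_C_mul_le v T).trans hT.1)) fun i hi => ?_⟩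
    obtain ⟨h0, h1⟩ := hTℓ i hi
    have h2 := hpl i hi
    simp only [hp] at h2
    rw [div_eq_iff hve] at h2
    refine mul_right_cancel₀ h0 ?_
    rw [h2, eval_mul, eval_C, mul_assoc, h1]
    ring
  · rintro ⟨v, hv, rfl⟩
    have hval : ∀ ζ, ‖(C v * T).eval ζ‖ = ‖T.eval ζ‖ := fun ζ => by
      rw [eval_mul, eval_C, norm_mul, hv, one_mul]
    refine ⟨⟨(natDegree_C_mul_le v T).trans hT.1, fun ζ hζ => (hval ζ).le.trans (hT.2 ζ hζ)⟩, ?_⟩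
    intro Q hQ
    rw [hval, hTnorm]
    exact hQΛ Q hQ

end Remez

/-! ### The main theorem -/

theorem theorem3 (n : ℕ) (hn : 1 ≤ n) (E : Set ℂ) (hE : IsClosed E)
    (hET : E ⊆ Metric.sphere (0 : ℂ) 1) (a₀ b₀ : ℝ) (hgap : Remez.IsGap E a₀ b₀)
    (c₀ : ℝ) (hc₀ : c₀ ∈ Set.Ioo a₀ b₀) :
    ((n : ℕ∞) < E.encard → ∃ P : Polynomial ℂ, Remez.IsExtremizer n E c₀ P) ∧
    ∀ P : Polynomial ℂ, Remez.IsExtremizer n E c₀ P →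
      ∃ (u : ℂ) (T : Polynomial ℂ), ‖u‖ = 1 ∧ P = Polynomial.C u * T ∧
        (∃ θ : ℂ → ℂ, Remez.IsCombMap n a₀ b₀ θ ∧
          ∀ z ∈ Remez.upperHalf,
            T.eval (Complex.exp (Complex.I * z)) =
              Complex.exp (Complex.I * n * z / 2) * Complex.cos ((n : ℂ) / 2 * θ z)) ∧
        (∀ c ∈ Set.Ioo a₀ b₀,
          T.eval (Remez.circlePt c) =
            Complex.exp (Complex.I * n * c / 2) * (‖T.eval (Remez.circlePt c)‖ : ℂ)) ∧
        ∀ c ∈ Set.Ioo a₀ b₀, ∀ Q : Polynomial ℂ,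
          Remez.IsExtremizer n E c Q ↔ ∃ v : ℂ, ‖v‖ = 1 ∧ Q = Polynomial.C v * T := by
  refine ⟨fun h => Remez.exists_isExtremizer h c₀, fun P hP => ?_⟩
  obtain ⟨Q, hQ, hQreal⟩ := hP.exists_real hET hgap
  obtain ⟨x, σ, hσ, hxb, hxa, hx, hxE⟩ := hQ.exists_alternation hn hE hET hgap hc₀ hQreal
  -- The sign makes the alternation start with `+1` at `x 0`, hence `t = 1` at both ends of the gap.
  set T : Polynomial ℂ := Polynomial.C (σ : ℂ) * Q with hT
  have hTtrig : ∀ z, Remez.trig n T z = σ * Remez.trig n Q z := fun z => by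
    simp only [Remez.trig, hT, Polynomial.eval_mul, Polynomial.eval_C]; ring
  have hσ1 : |σ| = 1 := by
    rw [← sq_eq_sq₀ (abs_nonneg σ) zero_le_one, sq_abs, hσ, one_pow]
  have hTnorm : ∀ ζ, ‖T.eval ζ‖ = ‖Q.eval ζ‖ := fun ζ => by
    rw [hT, Polynomial.eval_mul, Polynomial.eval_C, norm_mul, Complex.norm_real, Real.norm_eq_abs, hσ1,
      one_mul]
  have hTb : T ∈ Remez.boundedPolys n E :=
    ⟨(Polynomial.natDegree_C_mul_le _ _).trans hQ.1.1, fun ζ hζ => (hTnorm ζ).le.trans (hQ.1.2 ζ hζ)⟩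
  have hTreal : ∀ y : ℝ, (Remez.trig n T y).im = 0 := fun y => by
    rw [hTtrig, Complex.im_ofReal_mul, hQreal, mul_zero]
  have halt : ∀ i ≤ n, (Remez.trig n T (x i)).re = (-1) ^ i := fun i hi => by
    rw [hTtrig, Complex.re_ofReal_mul, (hxE i hi).2, ← mul_assoc, ← sq, hσ, one_mul]
  have haltC : ∀ i ≤ n, Remez.trig n T (x i) = (-1) ^ i := fun i hi => by
    rw [← Remez.ofReal_trig_re hTreal, halt i hi]; push_cast; rfl
  have hbd : ∀ y : ℝ, Remez.circlePt y ∈ E → (Remez.trig n T y).re ≤ 1 := fun y hy =>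
    (Complex.re_le_norm _).trans ((Remez.norm_trig_ofReal n T y).le.trans (hTb.2 _ hy))
  have hxlt : ∀ i j, i < j → j ≤ n → x i < x j := by
    intro i j hij
    induction j, hij using Nat.le_induction with
    | base => exact fun h => hx i h
    | succ m hm ih => exact fun h => (ih (by omega)).trans (hx m h)
  have hxle : ∀ i j, i ≤ j → j ≤ n → x i ≤ x j := fun i j hij hj => by
    rcases hij.eq_or_lt with rfl | h
    · exact le_rfl
    · exact (hxlt i j h hj).le
  have hxI : ∀ c ∈ Set.Ioo a₀ b₀, ∀ i ≤ n, x i ∈ Set.Ioo c (c + 2 * Real.pi) := fun c hc i hi =>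
    ⟨by linarith [hxle 0 i (Nat.zero_le i) hi, hc.2], by linarith [hxle i n hi le_rfl, hc.1]⟩
  have hmain := fun c hc => Remez.isExtremizer_iff_of_alternation hTb hxlt (fun i hi => (hxE i hi).1)
    haltC (hxI c hc)
  obtain ⟨u, hu, hPu⟩ := ((hmain c₀ hc₀).2 P).1 hP
  obtain ⟨θ, hθ, hcos⟩ := Remez.exists_isCombMap_of_alternation hn hTb.1 hTreal hgap.1 hxb hxa hx halt
    (hbd a₀ hgap.2.1) (hbd b₀ hgap.2.2.1)
  exact ⟨u, T, hu, hPu, ⟨θ, hθ, fun z hz => by rw [← hcos z hz, Remez.exp_mul_trig]⟩,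
    fun c hc => (hmain c hc).1, fun c hc => (hmain c hc).2⟩
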